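/- Let $m\in\mathbb{N}$ and let $y=\{y_k;\,k\in\mathbb{Z}\}$ be an $\mathbb{R}^m$-valued, zero-mean, stationary Gaussian process on a probability space. Its covariance lags are $C_l:=\mathbb{E}[y_{k+l}y_k^\top]$, $l\in\mathbb{Z}$, and its spectral measure $F$ is the bounded, non-negative Hermitian matrix-valued measure on $(-\pi,\pi]$ with $C_l=\frac{1}{2\pi}\int_{(-\pi,\pi]}e^{\mathrm{j}l\vartheta}\,dF(\vartheta)$ for all $l\in\mathbb{Z}$. For real $\vartheta_1,\vartheta_2$ put $$\chi_k(\vartheta_1,\vartheta_2):=\frac{e^{-\mathrm{j}\vartheta_2k}-e^{-\mathrm{j}\vartheta_1k}}{-2\pi\mathrm{j}k}\quad(k\ne0),\qquad \chi_0(\vartheta_1,\vartheta_2):=\frac{\vartheta_2-\vartheta_1}{2\pi},$$ and let the spectral increments be defined by $$\hat y(e^{\mathrm{j}\vartheta_1},e^{\mathrm{j}\vartheta_2}):=\lim_{N\to\infty}\sum_{k=-N}^{N}\chi_k(\vartheta_1,\vartheta_2)\,y_k\qquad\text{(limit in mean square)},$$ understood as functions of the angles $\vartheta_1,\vartheta_2$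 (so that $-\pi$ and $\pi$ are distinguished), up to almost sure equality. Then: 1. For all $\vartheta_1,\vartheta_2\in[-\pi,\pi]$ the limit defining $\hat y(e^{\mathrm{j}\vartheta_1},e^{\mathrm{j}\vartheta_2})$ exists in mean square. 2. For all $\vartheta_1,\vartheta_2\in(-\pi,\pi]$, almost surely $\hat y(e^{-\mathrm{j}\vartheta_2},e^{-\mathrm{j}\vartheta_1})=\overline{\hat y(e^{\mathrm{j}\vartheta_1},e^{\mathrm{j}\vartheta_2})}$. 3. Let $\vartheta_1,\vartheta_2\in(-\pi,\pi]$ have the same sign, i.e. both are $\ge0$ or both are $\le0$. If $\vartheta_1\neq\vartheta_2$, suppose moreover that $F(\{\tau\})=0$ for every $\tau\in\{\vartheta_1,\vartheta_2\}\cap\{0,\pi\}$ (no condition if neither angle is $0$ or $\pi$; automatic if $F$ is absolutely continuous). Then $Z:=\hat y(e^{\mathrm{j}\vartheta_1},e^{\mathrm{j}\vartheta_2})$ is a circularly symmetric, normally distributed random vector: its real and imaginary parts are jointly Gaussian (possibly degenerate), $\mathbb{E}[Z]=0$ and $\mathbb{E}[ZZ^\top]=0$. 4. Let $\vartheta_1,\vartheta_2,\vartheta_3,\vartheta_4\in(-\pi,\pi]$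 with $\vartheta_1\le\vartheta_2$, $\vartheta_3\le\vartheta_4$ and $[\vartheta_1,\vartheta_2]\cap[\vartheta_3,\vartheta_4]=[\vartheta_1,\vartheta_2]\cap[-\vartheta_4,-\vartheta_3]=\emptyset$. Then $\hat y(e^{\mathrm{j}\vartheta_1},e^{\mathrm{j}\vartheta_2})$ and $\hat y(e^{\mathrm{j}\vartheta_3},e^{\mathrm{j}\vartheta_4})$ are independent random vectors. -/

import Mathlib

open MeasureTheory ProbabilityTheory Filter Topology
open scoped ComplexOrder

noncomputable section

namespace SpectralRep

variable {Ω : Type*} [MeasurableSpace Ω] {m : ℕ}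

/-- A family `y = {y_k ; k ∈ ℤ}` of `ℝ^m`-valued random vectors is a zero-mean, stationary,
Gaussian process: all finite families of its components are jointly Gaussian, every `y_k` has
mean zero, and the covariance `E[y_{k+l} y_kᵀ]` does not depend on `k`. (For a zero-mean Gaussian
process this second-order condition is the same as shift invariance of the law.) -/
structure IsStationaryGaussian (μ : Measure Ω) (y : ℤ → Ω → EuclideanSpace ℝ (Fin m)) :
    Prop where
  gaussian : IsGaussianProcess y μ
  mean_zero : ∀ (k : ℤ) (i : Fin m), ∫ ω, y k ω i ∂μ = 0
  stationary : ∀ (k l : ℤ) (i j : Fin m),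
    ∫ ω, y (k + l) ω i * y k ω j ∂μ = ∫ ω, y l ω i * y 0 ω j ∂μ

/-- The covariance lags `C_l = E[y_{k+l} y_kᵀ]`, evaluated at `k = 0`. -/
def covLag (μ : Measure Ω) (y : ℤ → Ω → EuclideanSpace ℝ (Fin m)) (l : ℤ) :
    Matrix (Fin m) (Fin m) ℝ :=
  Matrix.of fun i j => ∫ ω, y l ω i * y 0 ω j ∂μ

/-- `F` is a spectral measure of `y`: a (bounded) non-negative Hermitian matrix-valued measure
on `(-π, π]` with `C_l = (2π)⁻¹ ∫ e^{jlϑ} dF(ϑ)` for all `l`. -/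
structure IsSpectralMeasure (μ : Measure Ω) (y : ℤ → Ω → EuclideanSpace ℝ (Fin m))
    (F : Fin m → Fin m → ComplexMeasure ℝ) : Prop where
  supported : ∀ (i j : Fin m) (A : Set ℝ), MeasurableSet A →
    Disjoint A (Set.Ioc (-Real.pi) Real.pi) → F i j A = 0
  nonneg : ∀ A : Set ℝ, MeasurableSet A →
    (Matrix.of fun i j => F i j A : Matrix (Fin m) (Fin m) ℂ).PosSemidef
  covLag_eq : ∀ (l : ℤ) (i j : Fin m),
    ((covLag μ y l i j : ℝ) : ℂ) =
      (2 * (Real.pi : ℂ))⁻¹ *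
        ∫ᵛ t, Complex.exp (Complex.I * l * (t : ℂ)) ∂[ContinuousLinearMap.mul ℝ ℂ; F i j]

/-- The spectral measure of `y` has no mass at the frequency `τ ∈ (-π, π]`. -/
def NoSpectralMassAt (μ : Measure Ω) (y : ℤ → Ω → EuclideanSpace ℝ (Fin m)) (τ : ℝ) : Prop :=
  ∃ F : Fin m → Fin m → ComplexMeasure ℝ,
    IsSpectralMeasure μ y F ∧ ∀ i j : Fin m, F i j {τ} = 0

/-- The coefficients `χ_k(ϑ₁, ϑ₂)`. -/
def chi (k : ℤ) (t₁ t₂ : ℝ) : ℂ :=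
  if k = 0 then ((t₂ : ℂ) - t₁) / (2 * Real.pi)
  else (Complex.exp (-Complex.I * t₂ * k) - Complex.exp (-Complex.I * t₁ * k)) /
    (-2 * Real.pi * Complex.I * k)

/-- The partial sums `∑_{k=-N}^{N} χ_k(ϑ₁, ϑ₂) y_k`. -/
def partialSum (y : ℤ → Ω → EuclideanSpace ℝ (Fin m)) (t₁ t₂ : ℝ) (N : ℕ) (ω : Ω) :
    EuclideanSpace ℂ (Fin m) :=
  ∑ k ∈ Finset.Icc (-(N : ℤ)) (N : ℤ),
    chi k t₁ t₂ • (WithLp.toLp 2 fun i : Fin m => ((y k ω i : ℝ) : ℂ))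

/-- `Z` is the mean-square limit of the partial sums `∑_{k=-N}^{N} χ_k(ϑ₁, ϑ₂) y_k`. -/
structure IsSpectralIncrement (μ : Measure Ω) (y : ℤ → Ω → EuclideanSpace ℝ (Fin m))
    (t₁ t₂ : ℝ) (Z : Ω → EuclideanSpace ℂ (Fin m)) : Prop where
  memLp : MemLp Z 2 μ
  tendsto : Tendsto (fun N : ℕ => eLpNorm (fun ω => partialSum y t₁ t₂ N ω - Z ω) 2 μ)
    atTop (𝓝 0)

open Classical in
/-- The spectral increment `ŷ(e^{jϑ₁}, e^{jϑ₂})`, as a function of the angles `ϑ₁, ϑ₂`: a version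
of the mean-square limit of the partial sums (and `0` should the limit not exist). -/
def yhat (μ : Measure Ω) (y : ℤ → Ω → EuclideanSpace ℝ (Fin m)) (t₁ t₂ : ℝ) :
    Ω → EuclideanSpace ℂ (Fin m) :=
  if h : ∃ Z : Ω → EuclideanSpace ℂ (Fin m), IsSpectralIncrement μ y t₁ t₂ Z then h.choose
  else 0

/-- A `ℂ^m`-valued random vector `Z = α + jβ` is circularly symmetric normally distributed:
`α` and `β` are jointly Gaussian, `E[Z] = 0` and `E[Z Zᵀ] = 0`. Degenerate Gaussian laws are
allowed. -/
structure IsCircularlySymmetricGaussian (μ : Measure Ω) (Z : Ω → EuclideanSpace ℂ (Fin m)) :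
    Prop where
  gaussian : HasGaussianLaw
    (fun ω => ((fun i => (Z ω i).re, fun i => (Z ω i).im) : (Fin m → ℝ) × (Fin m → ℝ))) μ
  mean_zero : ∀ i : Fin m, ∫ ω, Z ω i ∂μ = 0
  pseudoCov_zero : ∀ i j : Fin m, ∫ ω, Z ω i * Z ω j ∂μ = 0

end SpectralRep

end

/-!
Seen as a sequence `w_k` in the Hilbert space `L²(μ; ℂ^m)`, the process has a shift-invariant Gram
matrix, so Herglotz' theorem gives `⟪w_k, w_l⟫ = ∫ e^{j(l-k)t} dν(t)` for a finite positive measure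
`ν` on `(-π, π]`. Inner products of partial sums `∑ χ_k w_k` are therefore integrals of products of
trigonometric polynomials. These are Fourier partial sums of indicators of arcs, that is,
differences of sawtooth series, and so converge boundedly; by dominated convergence the partial sums
are Cauchy. The inner product of two limits is the integral of the product of the two limiting
indicators, which vanishes as soon as their supports share only countably many frequencies without
spectral mass (atoms are read off from the covariances by Wiener's Cesàro means); polarization
extends this to the components of the process.

Complex conjugation turns the increment over `(ϑ₁, ϑ₂)` into the one over `(-ϑ₂, -ϑ₁)`, so
`E[Z Z'ᵀ]` is such an inner product as well. Joint Gaussianity survives mean-square limits, and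
uncorrelated jointly Gaussian vectors are independent.
-/

noncomputable section

namespace SpectralRep

section Sawtooth

theorem norm_sum_smul_le_of_antitone {E : Type*} [SeminormedAddCommGroup E] [NormedSpace ℝ E]
    {a : ℕ → ℝ} {z : ℕ → E} {b : ℝ} (ha : Antitone a) (ha0 : ∀ n, 0 ≤ a n)
    (hz : ∀ n, ‖∑ k ∈ Finset.range n, z k‖ ≤ b) (N : ℕ) :
    ‖∑ k ∈ Finset.range N, a k • z k‖ ≤ a 0 * b := by
  have hdiff : ∀ k, 0 ≤ a k - a (k + 1) := fun k => sub_nonneg.2 (ha k.le_succ)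
  have abel : ∑ k ∈ Finset.range N, a k • z k = a N • ∑ k ∈ Finset.range N, z k +
      ∑ k ∈ Finset.range N, (a k - a (k + 1)) • ∑ j ∈ Finset.range (k + 1), z j := by
    induction N with
    | zero => simp
    | succ n ih =>
      rw [Finset.sum_range_succ, ih, Finset.sum_range_succ (fun k => (a k - a (k + 1)) • _),
        Finset.sum_range_succ z]
      module
  calc _ ≤ ‖a N • ∑ k ∈ Finset.range N, z k‖ + ∑ k ∈ Finset.range N,
        ‖(a k - a (k + 1)) • ∑ j ∈ Finset.range (k + 1), z j‖ := by
        rw [abel]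
        exact norm_add_le_of_le le_rfl (norm_sum_le _ _)
    _ ≤ a N * b + ∑ k ∈ Finset.range N, (a k - a (k + 1)) * b := by
        gcongr with k _
        · rw [norm_smul_of_nonneg (ha0 N)]
          exact mul_le_mul_of_nonneg_left (hz _) (ha0 _)
        · rw [norm_smul_of_nonneg (hdiff k)]
          exact mul_le_mul_of_nonneg_left (hz _) (hdiff k)
    _ = a 0 * b := by
        rw [← Finset.sum_mul, Finset.sum_range_sub']; ring

theorem norm_pow_sub_one_le {z : ℂ} (hz : ‖z‖ ≤ 1) (n : ℕ) : ‖z ^ n - 1‖ ≤ n * ‖z - 1‖ := by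
  rw [← geom_sum_mul, norm_mul]
  gcongr
  refine (norm_sum_le_of_le _ fun k _ => ?_).trans (by simp : ∑ k ∈ Finset.range n, (1 : ℝ) ≤ n)
  exact (norm_pow z k).trans_le (pow_le_one₀ (norm_nonneg z) hz)

theorem norm_sum_pow_add_le {z : ℂ} (hz : ‖z‖ ≤ 1) (hz1 : z ≠ 1) (n M : ℕ) :
    ‖∑ k ∈ Finset.range M, z ^ (n + k)‖ ≤ 2 / ‖z - 1‖ := by
  have hpow : ∀ k, ‖z ^ k‖ ≤ 1 := fun k =>
    (norm_pow z k).trans_le (pow_le_one₀ (norm_nonneg z) hz)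
  have htel : (∑ k ∈ Finset.range M, z ^ (n + k)) * (z - 1) = z ^ n * (z ^ M - 1) := by
    simp only [pow_add, ← Finset.mul_sum, mul_assoc, geom_sum_mul]
  rw [le_div_iff₀ (norm_pos_iff.2 (sub_ne_zero.2 hz1)), ← norm_mul, htel, norm_mul]
  calc ‖z ^ n‖ * ‖z ^ M - 1‖ ≤ 1 * (1 + 1) := by
        gcongr
        · exact hpow n
        · exact norm_sub_le_of_le (hpow M) norm_one.le
    _ = 2 := by norm_num

theorem sum_range_pow_div (z : ℂ) (N : ℕ) :
    ∑ k ∈ Finset.range (N + 1), z ^ k / k =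
      ∑ k ∈ Finset.range N, ((k : ℝ) + 1)⁻¹ • z ^ (1 + k) := by
  rw [Finset.sum_range_succ']
  simp [div_eq_inv_mul, add_comm]

theorem tendsto_sum_pow_div {z : ℂ} (hz : ‖z‖ ≤ 1) (hz1 : z ≠ 1) :
    Tendsto (fun N => ∑ k ∈ Finset.range N, z ^ k / k) atTop (𝓝 (-Complex.log (1 - z))) := by
  have hcauchy : CauchySeq fun N => ∑ k ∈ Finset.range (N + 1), z ^ k / k := by
    simp only [sum_range_pow_div]
    exact Antitone.cauchySeq_series_mul_of_tendsto_zero_of_bounded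
      (f := fun k : ℕ => ((k : ℝ) + 1)⁻¹) (fun i j hij => by dsimp only; gcongr)
      (by simpa using tendsto_one_div_add_atTop_nhds_zero_nat (𝕜 := ℝ))
      (norm_sum_pow_add_le hz hz1 1)
  obtain ⟨l, hl⟩ := cauchySeq_tendsto_of_complete hcauchy
  rw [tendsto_add_atTop_iff_nat (f := fun N => ∑ k ∈ Finset.range N, z ^ k / k)] at hl
  have hslit : 1 - z ∈ Complex.slitPlane := by
    have hre : z.re ≤ 1 := (Complex.re_le_norm z).trans hz
    refine Complex.mem_slitPlane_iff.2 (or_iff_not_imp_left.2 fun hre' him => hz1 ?_)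
    simp only [Complex.sub_re, Complex.one_re, sub_pos, not_lt] at hre'
    simp only [Complex.sub_im, Complex.one_im, zero_sub, neg_eq_zero] at him
    exact Complex.ext (le_antisymm hre hre') him
  have hlog : Tendsto (fun r : ℝ => -Complex.log (1 - r * z)) (𝓝[<] 1)
      (𝓝 (-Complex.log (1 - z))) := by
    have : ContinuousAt (fun r : ℝ => -Complex.log (1 - r * z)) 1 :=
      ((by fun_prop : ContinuousAt (fun r : ℝ => 1 - r * z) 1).clog (by simpa using hslit)).neg
    simpa using this.tendsto.mono_left nhdsWithin_le_nhds
  have habel : (fun r : ℝ => ∑' n : ℕ, z ^ n / n * (r : ℂ) ^ n) =ᶠ[𝓝[<] 1]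
      fun r => -Complex.log (1 - r * z) := by
    filter_upwards [Ioo_mem_nhdsLT (show (-1 : ℝ) < 1 by norm_num)] with r hr
    have hrz : ‖(r : ℂ) * z‖ < 1 := by
      rw [norm_mul, Complex.norm_real]
      exact mul_lt_one_of_nonneg_of_lt_one_left (norm_nonneg _) (abs_lt.2 hr) hz
    rw [← (Complex.hasSum_taylorSeries_neg_log hrz).tsum_eq]
    exact tsum_congr fun n => by ring
  have hlim := (tendsto_map'_iff.1 (Complex.tendsto_tsum_powerSeries_nhdsWithin_lt hl)).congr' habel
  rwa [tendsto_nhds_unique hlog hlim]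

theorem abs_im_sum_pow_div_le_mul {z : ℂ} (hz : ‖z‖ ≤ 1) (N : ℕ) :
    |(∑ k ∈ Finset.range (N + 1), z ^ k / k).im| ≤ N * ‖z - 1‖ := by
  rw [sum_range_pow_div, Complex.im_sum]
  refine (Finset.abs_sum_le_sum_abs _ _).trans
    ((Finset.sum_le_card_nsmul _ _ ‖z - 1‖ fun k _ => ?_).trans (by simp))
  rw [Complex.smul_im, smul_eq_mul, abs_mul, abs_of_pos (by positivity),
    inv_mul_le_iff₀ (by positivity)]
  calc |(z ^ (1 + k)).im| = |(z ^ (1 + k) - 1).im| := by simp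
    _ ≤ ((1 + k : ℕ) : ℝ) * ‖z - 1‖ := (Complex.abs_im_le_norm _).trans (norm_pow_sub_one_le hz _)
    _ = (k + 1) * ‖z - 1‖ := by push_cast; ring

theorem norm_sum_pow_div_sub_le {z : ℂ} (hz : ‖z‖ ≤ 1) (hz1 : z ≠ 1) (n M : ℕ) :
    ‖(∑ k ∈ Finset.range (n + M + 1), z ^ k / k) - ∑ k ∈ Finset.range (n + 1), z ^ k / k‖ ≤
      ((n : ℝ) + 1)⁻¹ * (2 / ‖z - 1‖) := by
  rw [sum_range_pow_div, sum_range_pow_div, Finset.sum_range_add, add_sub_cancel_left]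
  have := norm_sum_smul_le_of_antitone (a := fun k => (((n + k : ℕ) : ℝ) + 1)⁻¹)
    (fun i j hij => by dsimp only; gcongr) (fun k => by positivity)
    (norm_sum_pow_add_le hz hz1 (1 + n)) M
  simpa only [add_assoc, add_zero] using this

/-- The terms up to `1 / ‖z - 1‖` are bounded one by one, the oscillating tail by Abel's
inequality. -/
theorem abs_im_sum_pow_div_le {z : ℂ} (hz : ‖z‖ ≤ 1) (N : ℕ) :
    |(∑ k ∈ Finset.range (N + 1), z ^ k / k).im| ≤ 3 := by
  rcases eq_or_ne z 1 with rfl | hz1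
  · simp
  set d := ‖z - 1‖
  have hd0 : 0 < d := norm_pos_iff.2 (sub_ne_zero.2 hz1)
  set n := ⌊d⁻¹⌋₊
  have hnd : n * d ≤ 1 := (le_div_iff₀ hd0).1 (by simpa using Nat.floor_le (inv_nonneg.2 hd0.le))
  rcases le_total N n with hNn | hnN
  · calc _ ≤ N * d := abs_im_sum_pow_div_le_mul hz N
      _ ≤ n * d := by gcongr
      _ ≤ 3 := by linarith
  · obtain ⟨M, rfl⟩ := Nat.exists_eq_add_of_le hnN
    have htail : ((n : ℝ) + 1)⁻¹ * (2 / d) ≤ 2 := by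
      have : 1 / d < n + 1 := by simpa using Nat.lt_floor_add_one d⁻¹
      rw [inv_mul_le_iff₀ (by positivity), mul_comm, div_eq_mul_one_div]
      gcongr
    have hdiff := (Complex.abs_im_le_norm _).trans (norm_sum_pow_div_sub_le hz hz1 n M)
    rw [Complex.sub_im] at hdiff
    have hhead := abs_im_sum_pow_div_le_mul hz n
    rw [abs_le] at *
    constructor <;> linarith [hdiff.1, hdiff.2, hhead.1, hhead.2]

/-- The partial sums of the sawtooth Fourier series `∑ sin (k x) / k`; the term `k = 0` is `0`. -/
def sinSum (N : ℕ) (x : ℝ) : ℝ := ∑ k ∈ Finset.range (N + 1), Real.sin (k * x) / k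

/-- The `2π`-periodic sawtooth function: `(π - x) / 2` for `0 < x < 2π` and `0` at `x = 0`, where
`arg 0 = 0`. -/
def sawtooth (x : ℝ) : ℝ := -(1 - Complex.exp (x * Complex.I)).arg

theorem sinSum_eq_im (N : ℕ) (x : ℝ) :
    sinSum N x = (∑ k ∈ Finset.range (N + 1), Complex.exp (x * Complex.I) ^ k / k).im := by
  rw [sinSum, Complex.im_sum]
  refine Finset.sum_congr rfl fun k _ => ?_
  rw [← Complex.exp_nat_mul, ← mul_assoc, ← Complex.ofReal_natCast, ← Complex.ofReal_mul,
    Complex.div_ofReal_im, Complex.exp_ofReal_mul_I_im]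

theorem abs_sinSum_le (N : ℕ) (x : ℝ) : |sinSum N x| ≤ 3 := by
  rw [sinSum_eq_im]
  exact abs_im_sum_pow_div_le (Complex.norm_exp_ofReal_mul_I x).le N

theorem tendsto_sinSum (x : ℝ) : Tendsto (fun N => sinSum N x) atTop (𝓝 (sawtooth x)) := by
  simp only [sinSum_eq_im, sawtooth]
  rcases eq_or_ne (Complex.exp (x * Complex.I)) 1 with hx | hx
  · simp [hx]
  · have := (Complex.continuous_im.tendsto _).comp ((tendsto_add_atTop_iff_nat 1).2
      (tendsto_sum_pow_div (Complex.norm_exp_ofReal_mul_I x).le hx))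
    simpa only [Complex.neg_im, Complex.log_im, Function.comp_def] using this

theorem sawtooth_eq {x : ℝ} (h0 : 0 < x) (h1 : x < 2 * Real.pi) :
    sawtooth x = (Real.pi - x) / 2 := by
  have hs : 0 < 2 * Real.sin (x / 2) :=
    mul_pos two_pos (Real.sin_pos_of_pos_of_lt_pi (by linarith) (by linarith))
  have hpolar : 1 - Complex.exp (x * Complex.I) =
      ((2 * Real.sin (x / 2) : ℝ) : ℂ) *
        (Complex.cos ((x - Real.pi) / 2 : ℝ) +
          Complex.sin ((x - Real.pi) / 2 : ℝ) * Complex.I) := by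
    rw [← Complex.ofReal_cos, ← Complex.ofReal_sin, sub_div, Real.cos_sub_pi_div_two,
      Real.sin_sub_pi_div_two, Complex.exp_mul_I]
    have hcos : Complex.cos x = 1 - 2 * Complex.sin (x / 2) ^ 2 := by
      rw [← mul_div_cancel₀ (x : ℂ) two_ne_zero, Complex.cos_two_mul, Complex.cos_sq']; ring_nf
    have hsin : Complex.sin x = 2 * Complex.sin (x / 2) * Complex.cos (x / 2) := by
      rw [← Complex.sin_two_mul, mul_div_cancel₀ _ two_ne_zero]
    rw [hcos, hsin]
    push_cast
    ring
  rw [sawtooth, hpolar, Complex.arg_mul_cos_add_sin_mul_I hs ⟨by linarith, by linarith⟩]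
  ring

theorem sawtooth_sub_int_mul_two_pi (x : ℝ) (n : ℤ) :
    sawtooth (x - n * (2 * Real.pi)) = sawtooth x := by
  have := Complex.exp_periodic.sub_zsmul_eq (x := x * Complex.I) n
  rw [sawtooth, sawtooth, ← this]
  push_cast [zsmul_eq_mul]
  ring_nf

end Sawtooth

section ChiPoly

/-- The trigonometric polynomial `∑_{|k| ≤ N} χ_k(ϑ₁, ϑ₂) e^{jkt}`, a Fourier partial sum of the
indicator of the arc from `ϑ₁` to `ϑ₂`. -/
def chiPoly (t₁ t₂ : ℝ) (N : ℕ) (t : ℝ) : ℂ :=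
  ∑ k ∈ Finset.Icc (-(N : ℤ)) N, chi k t₁ t₂ * Complex.exp (Complex.I * k * t)

/-- The pointwise limit of `chiPoly`; for `ϑ₁ < ϑ₂ < ϑ₁ + 2π` it is the indicator of the arc from
`ϑ₁` to `ϑ₂`, with the value `1 / 2` at the endpoints. -/
def chiLimit (t₁ t₂ t : ℝ) : ℝ :=
  (t₂ - t₁) / (2 * Real.pi) + (sawtooth (t - t₁) - sawtooth (t - t₂)) / Real.pi

theorem chi_mul_exp {k : ℤ} (hk : k ≠ 0) (t₁ t₂ t : ℝ) :
    chi k t₁ t₂ * Complex.exp (Complex.I * k * t) =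
      (Complex.exp (k * (t - t₁) * Complex.I) - Complex.exp (k * (t - t₂) * Complex.I)) /
        (2 * Real.pi * k * Complex.I) := by
  have hexp : ∀ s : ℝ, Complex.exp (k * (t - s) * Complex.I) =
      Complex.exp (-Complex.I * s * k) * Complex.exp (Complex.I * k * t) := fun s => by
    rw [← Complex.exp_add]; ring_nf
  rw [chi, if_neg hk, hexp, hexp]
  ring

theorem chi_mul_exp_add_neg {k : ℕ} (hk : k ≠ 0) (t₁ t₂ t : ℝ) :
    chi k t₁ t₂ * Complex.exp (Complex.I * (k : ℤ) * t) +
      chi (-k : ℤ) t₁ t₂ * Complex.exp (Complex.I * (-k : ℤ) * t) =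
      ((Real.sin (k * (t - t₁)) / k - Real.sin (k * (t - t₂)) / k) / Real.pi : ℝ) := by
  rw [chi_mul_exp (by exact_mod_cast hk), chi_mul_exp (by simpa using hk)]
  push_cast [Complex.sin]
  simp only [neg_mul]
  have hk' : (k : ℂ) ≠ 0 := by exact_mod_cast hk
  field_simp
  rw [Complex.I_sq]
  ring

theorem chiPoly_eq (t₁ t₂ : ℝ) (N : ℕ) (t : ℝ) :
    chiPoly t₁ t₂ N t =
      ((t₂ - t₁) / (2 * Real.pi) + (sinSum N (t - t₁) - sinSum N (t - t₂)) / Real.pi : ℝ) := by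
  induction N with
  | zero => simp [chiPoly, chi, sinSum]
  | succ N ih =>
    have hstep := chi_mul_exp_add_neg N.succ_ne_zero t₁ t₂ t
    have hsucc : ∀ x, sinSum (N + 1) x = sinSum N x + Real.sin ((N + 1 : ℕ) * x) / (N + 1 : ℕ) :=
      fun x => Finset.sum_range_succ _ _
    push_cast at hstep
    rw [chiPoly, Nat.cast_succ, Finset.sum_Icc_succ_eq_add_endpoints, ← chiPoly, ih, hsucc, hsucc]
    push_cast
    rw [hstep]
    ring

theorem norm_chiPoly_le (t₁ t₂ : ℝ) (N : ℕ) (t : ℝ) :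
    ‖chiPoly t₁ t₂ N t‖ ≤ |t₂ - t₁| / (2 * Real.pi) + 6 / Real.pi := by
  rw [chiPoly_eq, Complex.norm_real, Real.norm_eq_abs]
  refine (abs_add_le _ _).trans ?_
  rw [abs_div, abs_div, abs_of_pos Real.pi_pos, abs_of_pos Real.two_pi_pos]
  gcongr
  exact (abs_sub _ _).trans (by linarith [abs_sinSum_le N (t - t₁), abs_sinSum_le N (t - t₂)])

theorem tendsto_chiPoly (t₁ t₂ t : ℝ) :
    Tendsto (fun N => chiPoly t₁ t₂ N t) atTop (𝓝 (chiLimit t₁ t₂ t)) := by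
  simp only [chiPoly_eq]
  exact (Complex.continuous_ofReal.tendsto _).comp
    ((((tendsto_sinSum (t - t₁)).sub (tendsto_sinSum (t - t₂))).div_const _).const_add _)

theorem continuous_chiPoly (t₁ t₂ : ℝ) (N : ℕ) : Continuous (chiPoly t₁ t₂ N) := by
  unfold chiPoly
  fun_prop

theorem chiLimit_swap (t₁ t₂ t : ℝ) : chiLimit t₂ t₁ t = -chiLimit t₁ t₂ t := by
  simp only [chiLimit]
  ring

theorem chiLimit_self (t₁ t : ℝ) : chiLimit t₁ t₁ t = 0 := by
  simp [chiLimit]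

theorem exists_mem_Icc_of_chiLimit_ne_zero {t₁ t₂ t : ℝ} (h : t₁ ≤ t₂)
    (ht : chiLimit t₁ t₂ t ≠ 0) : ∃ s ∈ Set.Icc t₁ t₂, ∃ n : ℤ, t = s + n * (2 * Real.pi) := by
  contrapose! ht
  set n := ⌊(t - t₁) / (2 * Real.pi)⌋
  have hn : n * (2 * Real.pi) ≤ t - t₁ := (le_div_iff₀ Real.two_pi_pos).1 (Int.floor_le _)
  have hn' : t - t₁ < (n + 1) * (2 * Real.pi) :=
    (div_lt_iff₀ Real.two_pi_pos).1 (Int.lt_floor_add_one _)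
  have hlt : t₂ < t - n * (2 * Real.pi) := by
    by_contra! hle
    exact ht (t - n * (2 * Real.pi)) ⟨by linarith, hle⟩ n (by ring)
  have hsaw : ∀ s ∈ Set.Icc t₁ t₂, sawtooth (t - s) = (Real.pi - (t - s - n * (2 * Real.pi))) / 2 :=
    fun s hs => by
      rw [← sawtooth_sub_int_mul_two_pi (t - s) n]
      exact sawtooth_eq (by linarith [hs.2]) (by linarith [hs.1])
  rw [chiLimit, hsaw t₁ ⟨le_rfl, h⟩, hsaw t₂ ⟨h, le_rfl⟩]
  field_simp
  ring

theorem exists_mem_uIcc_of_chiLimit_ne_zero {t₁ t₂ t : ℝ} (ht : chiLimit t₁ t₂ t ≠ 0) :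
    ∃ s ∈ Set.uIcc t₁ t₂, ∃ n : ℤ, t = s + n * (2 * Real.pi) := by
  rcases le_total t₁ t₂ with h | h
  · rw [Set.uIcc_of_le h]
    exact exists_mem_Icc_of_chiLimit_ne_zero h ht
  · rw [Set.uIcc_of_ge h]
    exact exists_mem_Icc_of_chiLimit_ne_zero h (by rwa [chiLimit_swap, neg_ne_zero])

theorem conj_chi (k : ℤ) (t₁ t₂ : ℝ) : starRingEnd ℂ (chi k t₁ t₂) = chi k (-t₂) (-t₁) := by
  rcases eq_or_ne k 0 with rfl | hk
  · simp [chi, sub_eq_add_neg, add_comm, map_ofNat]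
  · simp only [chi, if_neg hk, map_div₀, map_sub, map_mul, map_neg, ← Complex.exp_conj,
      Complex.conj_I, Complex.conj_ofReal, map_intCast, map_ofNat, Complex.ofReal_neg]
    rw [← neg_div_neg_eq]
    ring_nf

end ChiPoly

/-- A sequence in a Hilbert space is stationary if its Gram matrix is invariant under shifts. -/
def IsStationarySeq {H : Type*} [NormedAddCommGroup H] [InnerProductSpace ℂ H]
    (w : ℤ → H) : Prop :=
  ∀ k l n : ℤ, inner ℂ (w (k + n)) (w (l + n)) = inner ℂ (w k) (w l)

section Herglotz

theorem exists_finiteMeasure_forall_integral_eq {X : Type*} [MeasurableSpace X]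
    [TopologicalSpace X] [T2Space X] [BorelSpace X] [CompactSpace X] (M : ℕ → FiniteMeasure X)
    {C : NNReal} (hM : ∀ n, (M n).mass ≤ C) :
    ∃ ν : FiniteMeasure X, ∀ (f : C(X, ℂ)) (l : ℂ),
      Tendsto (fun n => ∫ x, f x ∂(M n : Measure X)) atTop (𝓝 l) →
        ∫ x, f x ∂(ν : Measure X) = l := by
  have hcompact := isCompact_setOfPred_finiteMeasure_le_of_compactSpace X C
  obtain ⟨ν, -, hν⟩ := hcompact.ultrafilter_le_nhds ((hyperfilter ℕ).map M) (by
    rw [le_principal_iff]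
    exact Eventually.of_forall (f := (hyperfilter ℕ : Filter ℕ)) hM)
  have hlim : Tendsto M (hyperfilter ℕ) (𝓝 ν) := hν
  refine ⟨ν, fun f l hl => tendsto_nhds_unique ?_ (hl.mono_left Nat.hyperfilter_le_atTop)⟩
  exact (FiniteMeasure.tendsto_iff_forall_integral_rclike_tendsto ℂ).1 hlim
    (BoundedContinuousFunction.mkOfCompact f)

theorem integral_fourier_haarAddCircle {T : ℝ} [Fact (0 < T)] (j : ℤ) :
    ∫ x, fourier j x ∂(AddCircle.haarAddCircle (T := T)) = if j = 0 then 1 else 0 := by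
  have := congrFun (fourierCoeff_fourier (T := T) j) 0
  simpa [fourierCoeff, Pi.single_apply, eq_comm] using this

/-- The Fejér weight `(1 - |m| / (n + 1))₊`, written with truncated subtraction. -/
def fejerWeight (n : ℕ) (m : ℤ) : ℝ := ((n + 1 - m.natAbs : ℕ) : ℝ) / (n + 1)

theorem tendsto_fejerWeight (m : ℤ) : Tendsto (fun n => fejerWeight n m) atTop (𝓝 1) := by
  have hlim : Tendsto (fun n : ℕ => 1 - m.natAbs * (1 / ((n : ℝ) + 1))) atTop (𝓝 1) := by
    simpa using ((tendsto_one_div_add_atTop_nhds_zero_nat (𝕜 := ℝ)).const_mul _).const_sub 1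
  refine hlim.congr' ?_
  filter_upwards [eventually_ge_atTop m.natAbs] with n hn
  rw [fejerWeight, Nat.cast_sub (by omega), sub_div, mul_one_div]
  push_cast
  rw [div_self (by positivity)]

theorem card_filter_add_mem_Ico (n : ℕ) (m : ℤ) :
    {k ∈ Finset.Ico (0 : ℤ) (n + 1) | m + k ∈ Finset.Ico (0 : ℤ) (n + 1)}.card =
      n + 1 - m.natAbs := by
  have : {k ∈ Finset.Ico (0 : ℤ) (n + 1) | m + k ∈ Finset.Ico (0 : ℤ) (n + 1)} =
      Finset.Ico (max 0 (-m)) (min (n + 1) (n + 1 - m)) := by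
    ext k
    simp only [Finset.mem_filter, Finset.mem_Ico, lt_min_iff, max_le_iff]
    omega
  rw [this, Int.card_Ico]
  omega

variable {H : Type*} [NormedAddCommGroup H] [InnerProductSpace ℂ H] {w : ℤ → H} {T : ℝ}

theorem IsStationarySeq.inner_eq (hw : IsStationarySeq w) (k l : ℤ) :
    inner ℂ (w k) (w l) = inner ℂ (w 0) (w (l - k)) := by
  simpa using hw 0 (l - k) k

/-- The Hilbert space valued trigonometric polynomial `∑_{0 ≤ k ≤ n} e^{-jkx} w_k`, whose squared
norm is a Fejér-type density. -/
def trigSum (w : ℤ → H) (n : ℕ) (x : AddCircle T) : H :=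
  ∑ k ∈ Finset.Ico (0 : ℤ) (n + 1), fourier (-k) x • w k

theorem continuous_trigSum (w : ℤ → H) (n : ℕ) : Continuous (trigSum (T := T) w n) := by
  unfold trigSum
  fun_prop

theorem IsStationarySeq.normSq_trigSum (hw : IsStationarySeq w) (n : ℕ) (x : AddCircle T) :
    ((‖trigSum w n x‖ ^ 2 : ℝ) : ℂ) = ∑ k ∈ Finset.Ico (0 : ℤ) (n + 1),
      ∑ l ∈ Finset.Ico (0 : ℤ) (n + 1), inner ℂ (w 0) (w (l - k)) * fourier (k - l) x := by
  push_cast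
  refine (inner_self_eq_norm_sq_to_K (𝕜 := ℂ) (trigSum w n x)).symm.trans ?_
  rw [trigSum, sum_inner]
  simp only [inner_sum]
  refine Finset.sum_congr rfl fun k _ => Finset.sum_congr rfl fun l _ => ?_
  rw [inner_smul_left, inner_smul_right, hw.inner_eq, ← fourier_neg, neg_neg, ← mul_assoc,
    ← fourier_add, mul_comm, sub_eq_add_neg k l]

theorem IsStationarySeq.integral_normSq_trigSum_mul_fourier [Fact (0 < T)]
    (hw : IsStationarySeq w) (n : ℕ) (m : ℤ) :
    ∫ x, ((‖trigSum w n x‖ ^ 2 / (n + 1) : ℝ) : ℂ) * fourier m x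
      ∂(AddCircle.haarAddCircle (T := T)) = fejerWeight n m * inner ℂ (w 0) (w m) := by
  have hexpand : ∀ x : AddCircle T, ((‖trigSum w n x‖ ^ 2 / (n + 1) : ℝ) : ℂ) * fourier m x =
      ((n : ℂ) + 1)⁻¹ * ∑ k ∈ Finset.Ico (0 : ℤ) (n + 1), ∑ l ∈ Finset.Ico (0 : ℤ) (n + 1),
        inner ℂ (w 0) (w (l - k)) * fourier (m + (k - l)) x := fun x => by
    rw [Complex.ofReal_div, hw.normSq_trigSum]
    simp only [fourier_add (m := m), Finset.mul_sum, Finset.sum_mul, Finset.sum_div]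
    push_cast
    exact Finset.sum_congr rfl fun k _ => Finset.sum_congr rfl fun l _ => by ring
  have hint : ∀ (c : ℂ) (j : ℤ), Integrable (fun x => c * fourier j x)
      (AddCircle.haarAddCircle (T := T)) := fun c j =>
    ((map_continuous (fourier j)).integrable_of_hasCompactSupport
      (HasCompactSupport.of_compactSpace _)).const_mul c
  have hdiag : ∀ k l : ℤ, inner ℂ (w 0) (w (l - k)) * (if m + (k - l) = 0 then 1 else 0) =
      if m + k = l then inner ℂ (w 0) (w m) else 0 := fun k l => by
    simp only [← add_sub_assoc, sub_eq_zero]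
    split_ifs with h
    · rw [← h, add_sub_cancel_right, mul_one]
    · rw [mul_zero]
  simp_rw [hexpand]
  rw [integral_const_mul,
    integral_finsetSum _ fun _ _ => integrable_finsetSum _ fun _ _ => hint _ _]
  simp_rw [integral_finsetSum _ fun _ _ => hint _ _, integral_const_mul,
    integral_fourier_haarAddCircle, hdiag, Finset.sum_ite_eq]
  rw [← Finset.sum_filter, Finset.sum_const, card_filter_add_mem_Ico, nsmul_eq_mul, fejerWeight]
  push_cast
  ring

theorem IsStationarySeq.exists_measure_addCircle [Fact (0 < T)] (hw : IsStationarySeq w) :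
    ∃ ν : FiniteMeasure (AddCircle T), ∀ m : ℤ, ∫ x, fourier m x ∂(ν : Measure (AddCircle T)) =
      inner ℂ (w 0) (w m) := by
  let p : ℕ → AddCircle T → ℝ := fun n x => ‖trigSum w n x‖ ^ 2 / (n + 1)
  have hp : ∀ n, Continuous (p n) := fun n => by
    have := continuous_trigSum (T := T) w n
    fun_prop
  have hp0 : ∀ n x, 0 ≤ p n x := fun n x => by positivity
  let M : ℕ → FiniteMeasure (AddCircle T) := fun n =>
    ⟨AddCircle.haarAddCircle.withDensity fun x => ENNReal.ofReal (p n x),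
      isFiniteMeasure_withDensity_ofReal
        ((hp n).integrable_of_hasCompactSupport (HasCompactSupport.of_compactSpace _)).2⟩
  have hMint : ∀ n m, ∫ x, fourier m x ∂(M n : Measure (AddCircle T)) =
      fejerWeight n m * inner ℂ (w 0) (w m) := fun n m => by
    rw [← hw.integral_normSq_trigSum_mul_fourier (T := T)]
    refine (integral_withDensity_eq_integral_toReal_smul
      (hp n).measurable.ennreal_ofReal (by simp) _).trans ?_
    simp only [ENNReal.toReal_ofReal (hp0 n _), Complex.real_smul, p]
  have hmass : ∀ n, (M n).mass ≤ ‖w 0‖₊ ^ 2 := fun n => by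
    have hreal : (((M n).mass : ℝ) : ℂ) = ((‖w 0‖ ^ 2 : ℝ) : ℂ) := by
      have h0 := hMint n 0
      have hweight : fejerWeight n 0 = 1 := by
        simpa [fejerWeight] using div_self (show (n : ℝ) + 1 ≠ 0 by positivity)
      simp only [fourier_zero, integral_const, Complex.real_smul, mul_one, hweight,
        Complex.ofReal_one, one_mul, inner_self_eq_norm_sq_to_K] at h0
      rw [Complex.ofReal_pow]
      exact h0
    exact_mod_cast (Complex.ofReal_injective hreal).le
  obtain ⟨ν, hν⟩ := exists_finiteMeasure_forall_integral_eq M hmass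
  refine ⟨ν, fun m => hν (fourier m) _ ?_⟩
  simp_rw [hMint]
  simpa using ((Complex.continuous_ofReal.tendsto _).comp (tendsto_fejerWeight m)).mul_const
    (inner ℂ (w 0) (w m))

theorem IsStationarySeq.exists_measure (hw : IsStationarySeq w) :
    ∃ ν : Measure ℝ, IsFiniteMeasure ν ∧ (∀ᵐ t ∂ν, t ∈ Set.Ioc (-Real.pi) Real.pi) ∧
      ∀ k l : ℤ, inner ℂ (w k) (w l) = ∫ t : ℝ, Complex.exp (Complex.I * (l - k : ℤ) * t) ∂ν := by
  have : Fact (0 < 2 * Real.pi) := ⟨Real.two_pi_pos⟩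
  obtain ⟨ν, hν⟩ := hw.exists_measure_addCircle (T := 2 * Real.pi)
  let angle : AddCircle (2 * Real.pi) → ℝ := fun x =>
    AddCircle.measurableEquivIoc (2 * Real.pi) (-Real.pi) x
  have hangle : Measurable angle :=
    measurable_subtype_coe.comp (AddCircle.measurableEquivIoc (2 * Real.pi) (-Real.pi)).measurable
  refine ⟨(ν : Measure (AddCircle (2 * Real.pi))).map angle, inferInstance, ?_, fun k l => ?_⟩
  · refine (ae_map_iff hangle.aemeasurable measurableSet_Ioc).2 (.of_forall fun x => ?_)
    have := (AddCircle.measurableEquivIoc (2 * Real.pi) (-Real.pi) x).2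
    exact ⟨this.1, this.2.trans (by linarith)⟩
  · rw [hw.inner_eq, ← hν, integral_map hangle.aemeasurable (by fun_prop)]
    refine integral_congr_ae (.of_forall fun x => ?_)
    have hx : (angle x : AddCircle (2 * Real.pi)) = x := AddCircle.coe_equivIoc
    dsimp only
    conv_lhs => rw [← hx]
    rw [fourier_coe_apply]
    have : (Real.pi : ℂ) ≠ 0 := by exact_mod_cast Real.pi_ne_zero
    push_cast
    field_simp

end Herglotz

section Wiener

/-- The Cesàro means `N⁻¹ ∑_{n < N} e^{-jnτ} c_n`, which detect an atom at the frequency `τ` of a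
measure with Fourier coefficients `c_n`. -/
def cesaroMean (c : ℤ → ℂ) (τ : ℝ) (N : ℕ) : ℂ :=
  (N : ℂ)⁻¹ * ∑ n ∈ Finset.range N, Complex.exp (-Complex.I * n * τ) * c n

/-- The normalized one-sided Dirichlet kernel `N⁻¹ ∑_{n < N} e^{jnx}`. -/
def meanKernel (N : ℕ) (x : ℝ) : ℂ :=
  (N : ℂ)⁻¹ * ∑ n ∈ Finset.range N, Complex.exp (Complex.I * n * x)

theorem norm_exp_I_mul_int_mul (n : ℤ) (x : ℝ) : ‖Complex.exp (Complex.I * n * x)‖ = 1 := by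
  rw [show Complex.I * n * x = ((n * x : ℝ) : ℂ) * Complex.I by push_cast; ring,
    Complex.norm_exp_ofReal_mul_I]

theorem norm_meanKernel_le (N : ℕ) (x : ℝ) : ‖meanKernel N x‖ ≤ 1 := by
  rw [meanKernel, norm_mul, norm_inv, Complex.norm_natCast]
  refine inv_mul_le_one_of_le₀ ((norm_sum_le _ _).trans ?_) N.cast_nonneg
  refine (Finset.sum_le_card_nsmul _ _ 1 fun n _ => ?_).trans (by simp)
  exact_mod_cast (norm_exp_I_mul_int_mul n x).le

theorem continuous_meanKernel (N : ℕ) : Continuous (meanKernel N) := by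
  unfold meanKernel
  fun_prop

theorem tendsto_inv_mul_geom_sum {z : ℂ} (hz : ‖z‖ ≤ 1) (hz1 : z ≠ 1) :
    Tendsto (fun N : ℕ => (N : ℂ)⁻¹ * ∑ n ∈ Finset.range N, z ^ n) atTop (𝓝 0) := by
  refine squeeze_zero_norm (a := fun N : ℕ => (N : ℝ)⁻¹ * (2 / ‖z - 1‖)) (fun N => ?_) ?_
  · rw [norm_mul, norm_inv, Complex.norm_natCast]
    gcongr
    simpa using norm_sum_pow_add_le hz hz1 0 N
  · simpa using (tendsto_inv_atTop_nhds_zero_nat (𝕜 := ℝ)).mul_const (2 / ‖z - 1‖)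

theorem tendsto_meanKernel {t τ : ℝ} (ht : t ∈ Set.Ioc (-Real.pi) Real.pi)
    (hτ : τ ∈ Set.Ioc (-Real.pi) Real.pi) :
    Tendsto (fun N => meanKernel N (t - τ)) atTop
      (𝓝 (({τ} : Set ℝ).indicator (fun _ => (1 : ℂ)) t)) := by
  rcases eq_or_ne t τ with rfl | h
  · refine tendsto_const_nhds.congr' ?_
    filter_upwards [eventually_ne_atTop 0] with N hN
    simp [meanKernel, inv_mul_cancel₀ (Nat.cast_ne_zero.2 hN : (N : ℂ) ≠ 0)]
  · rw [Set.indicator_of_notMem (by simpa using h)]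
    have hz : Complex.exp ((t - τ : ℝ) * Complex.I) ≠ 1 := by
      rw [Complex.ofReal_sub, sub_mul, Complex.exp_sub, ne_eq,
        div_eq_one_iff_eq (Complex.exp_ne_zero _)]
      refine fun he => h (Complex.ofReal_injective (mul_right_cancel₀ Complex.I_ne_zero ?_))
      exact Complex.exp_inj_of_neg_pi_lt_of_le_pi (by simpa using ht.1) (by simpa using ht.2)
        (by simpa using hτ.1) (by simpa using hτ.2) he
    refine (tendsto_inv_mul_geom_sum (Complex.norm_exp_ofReal_mul_I _).le hz).congr fun N => ?_
    rw [meanKernel]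
    congr 1
    refine Finset.sum_congr rfl fun n _ => ?_
    rw [← Complex.exp_nat_mul]
    congr 1
    ring

theorem meanKernel_sub (N : ℕ) (t τ : ℝ) :
    meanKernel N (t - τ) = (N : ℂ)⁻¹ * ∑ n ∈ Finset.range N,
      Complex.exp (-Complex.I * n * τ) * Complex.exp (Complex.I * (n : ℤ) * t) := by
  rw [meanKernel]
  congr 1
  refine Finset.sum_congr rfl fun n _ => ?_
  rw [← Complex.exp_add]
  congr 1
  push_cast
  ring

theorem cesaroMean_integral {ν : Measure ℝ} [IsFiniteMeasure ν] (τ : ℝ) (N : ℕ) :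
    cesaroMean (fun n => ∫ t : ℝ, Complex.exp (Complex.I * n * t) ∂ν) τ N =
      ∫ t, meanKernel N (t - τ) ∂ν := by
  simp only [meanKernel_sub, cesaroMean]
  rw [integral_const_mul, integral_finsetSum]
  · simp only [integral_const_mul]
  · exact fun n _ => (Integrable.of_bound (C := 1) (by fun_prop)
      (.of_forall fun t => (norm_exp_I_mul_int_mul n t).le)).const_mul _

theorem measure_singleton_eq_zero_of_tendsto_cesaroMean {ν : Measure ℝ} [IsFiniteMeasure ν]
    (hν : ∀ᵐ t ∂ν, t ∈ Set.Ioc (-Real.pi) Real.pi) {τ : ℝ} (hτ : τ ∈ Set.Ioc (-Real.pi) Real.pi)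
    (h : Tendsto (cesaroMean (fun n => ∫ t : ℝ, Complex.exp (Complex.I * n * t) ∂ν) τ)
      atTop (𝓝 0)) : ν {τ} = 0 := by
  have hlim : Tendsto (fun N => ∫ t, meanKernel N (t - τ) ∂ν) atTop
      (𝓝 (∫ t, ({τ} : Set ℝ).indicator (fun _ => (1 : ℂ)) t ∂ν)) := by
    refine tendsto_integral_of_dominated_convergence (fun _ => 1) (fun N => ?_)
      (integrable_const _) (fun N => .of_forall fun t => norm_meanKernel_le _ _) ?_
    · exact ((continuous_meanKernel N).comp (by fun_prop)).aestronglyMeasurable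
    · filter_upwards [hν] with t ht using tendsto_meanKernel ht hτ
  have hmass := tendsto_nhds_unique (h.congr fun N => cesaroMean_integral τ N) hlim
  rw [integral_indicator_const _ (measurableSet_singleton τ), Complex.real_smul, mul_one] at hmass
  have hreal : ν.real {τ} = 0 := by exact_mod_cast hmass.symm
  exact (measureReal_eq_zero_iff (measure_ne_top ν _)).1 hreal

theorem vectorIntegral_const_mul {X : Type*} [MeasurableSpace X] (F : ComplexMeasure X) (a : ℂ)
    (f : X → ℂ) : ∫ᵛ t, a * f t ∂[ContinuousLinearMap.mul ℝ ℂ; F] =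
      a * ∫ᵛ t, f t ∂[ContinuousLinearMap.mul ℝ ℂ; F] := by
  rw [VectorMeasure.integral_eq_setToFun, VectorMeasure.integral_eq_setToFun]
  exact setToFun_smul (𝕜 := ℂ) _ (fun c s x => mul_assoc c x (F s)) a f

theorem vectorIntegral_indicator_one {X : Type*} [MeasurableSpace X] (F : ComplexMeasure X)
    [IsFiniteMeasure F.variation] {s : Set X} (hs : MeasurableSet s) :
    ∫ᵛ t, s.indicator (fun _ => (1 : ℂ)) t ∂[ContinuousLinearMap.mul ℝ ℂ; F] = F s := by
  rw [VectorMeasure.integral_eq_setToFun]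
  exact (setToFun_indicator_const _ hs (measure_ne_top _ _) (1 : ℂ)).trans (one_mul (F s))

theorem cesaroMean_vectorIntegral (F : ComplexMeasure ℝ) [IsFiniteMeasure F.variation] (τ : ℝ)
    (N : ℕ) :
    cesaroMean (fun n => ∫ᵛ t, Complex.exp (Complex.I * n * (t : ℂ))
      ∂[ContinuousLinearMap.mul ℝ ℂ; F]) τ N =
      ∫ᵛ t, meanKernel N (t - τ) ∂[ContinuousLinearMap.mul ℝ ℂ; F] := by
  simp only [meanKernel_sub, cesaroMean]
  rw [vectorIntegral_const_mul, VectorMeasure.integral_finsetSum]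
  · simp only [vectorIntegral_const_mul]
  · exact fun n _ => (Integrable.of_bound (C := 1) (by fun_prop)
      (.of_forall fun t => (norm_exp_I_mul_int_mul n t).le)).const_mul _

theorem tendsto_cesaroMean_vectorIntegral {F : ComplexMeasure ℝ}
    (hF : ∀ A, MeasurableSet A → Disjoint A (Set.Ioc (-Real.pi) Real.pi) → F A = 0) {τ : ℝ}
    (hτ : τ ∈ Set.Ioc (-Real.pi) Real.pi) (hmass : F {τ} = 0) :
    Tendsto (cesaroMean (fun n => ∫ᵛ t, Complex.exp (Complex.I * n * (t : ℂ))
      ∂[ContinuousLinearMap.mul ℝ ℂ; F]) τ) atTop (𝓝 0) := by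
  by_cases hfin : IsFiniteMeasure F.variation
  · have hsupp : ∀ᵐ t ∂F.variation, t ∈ Set.Ioc (-Real.pi) Real.pi :=
      (VectorMeasure.variation_apply_eq_zero measurableSet_Ioc.compl).2 fun A hA hAm =>
        hF A hAm (Set.disjoint_left.2 fun x hx => hA hx)
    rw [← hmass, ← vectorIntegral_indicator_one F (measurableSet_singleton τ)]
    simp only [funext (cesaroMean_vectorIntegral F τ)]
    refine VectorMeasure.tendsto_integral_of_dominated_convergence (fun _ => 1) (fun N => ?_)
      (integrable_const _) (fun N => .of_forall fun t => norm_meanKernel_le _ _) ?_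
    · exact ((continuous_meanKernel N).comp (by fun_prop)).aestronglyMeasurable
    · filter_upwards [hsupp] with t ht using tendsto_meanKernel ht hτ
  · -- Exponentials are then not integrable, and their integrals have the junk value `0`.
    have hzero : ∀ n : ℤ, ∫ᵛ t, Complex.exp (Complex.I * n * (t : ℂ))
        ∂[ContinuousLinearMap.mul ℝ ℂ; F] = 0 := fun n =>
      VectorMeasure.integral_undef fun hint => hfin (by
        have : Integrable (fun _ : ℝ => (1 : ℝ)) F.variation :=
          hint.norm.congr (.of_forall fun t => norm_exp_I_mul_int_mul n t)
        simpa [integrable_const_iff] using this)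
    refine tendsto_const_nhds.congr fun N => ?_
    simp only [cesaroMean, hzero, mul_zero, Finset.sum_const_zero]

theorem cesaroMean_const_mul (a : ℂ) (c : ℤ → ℂ) (τ : ℝ) (N : ℕ) :
    cesaroMean (fun n => a * c n) τ N = a * cesaroMean c τ N := by
  simp only [cesaroMean, Finset.mul_sum]
  exact Finset.sum_congr rfl fun n _ => by ring

theorem NoSpectralMassAt.tendsto_cesaroMean {Ω : Type*} [MeasurableSpace Ω] {m : ℕ}
    {μ : Measure Ω} {y : ℤ → Ω → EuclideanSpace ℝ (Fin m)} {τ : ℝ} (h : NoSpectralMassAt μ y τ)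
    (hτ : τ ∈ Set.Ioc (-Real.pi) Real.pi) (i j : Fin m) :
    Tendsto (cesaroMean (fun n => (covLag μ y n i j : ℂ)) τ) atTop (𝓝 0) := by
  obtain ⟨F, hF, hmass⟩ := h
  simp only [hF.covLag_eq, funext (cesaroMean_const_mul _ _ τ)]
  simpa using (tendsto_cesaroMean_vectorIntegral (hF.supported i j) hτ (hmass i j)).const_mul
    (2 * (Real.pi : ℂ))⁻¹

end Wiener

section ChiSum

variable {H : Type*} [NormedAddCommGroup H] [InnerProductSpace ℂ H] {w : ℤ → H} {ν : Measure ℝ}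

/-- The partial sums `∑_{k=-N}^{N} χ_k(ϑ₁, ϑ₂) w_k` in a complex vector space. -/
def chiSum {E : Type*} [AddCommGroup E] [Module ℂ E] (w : ℤ → E) (t₁ t₂ : ℝ) (N : ℕ) : E :=
  ∑ k ∈ Finset.Icc (-(N : ℤ)) (N : ℤ), chi k t₁ t₂ • w k

theorem conj_chiPoly_mul_chiPoly (t₁ t₂ t₃ t₄ : ℝ) (N M : ℕ) (t : ℝ) :
    starRingEnd ℂ (chiPoly t₁ t₂ N t) * chiPoly t₃ t₄ M t =
      ∑ k ∈ Finset.Icc (-(N : ℤ)) (N : ℤ), ∑ l ∈ Finset.Icc (-(M : ℤ)) (M : ℤ),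
        starRingEnd ℂ (chi k t₁ t₂) * chi l t₃ t₄ *
          Complex.exp (Complex.I * (l - k : ℤ) * t) := by
  rw [chiPoly, chiPoly, map_sum, Finset.sum_mul_sum]
  refine Finset.sum_congr rfl fun k _ => Finset.sum_congr rfl fun l _ => ?_
  have hexp : Complex.exp (Complex.I * (l - k : ℤ) * t) =
      Complex.exp (-Complex.I * k * t) * Complex.exp (Complex.I * l * t) := by
    rw [← Complex.exp_add]
    congr 1
    push_cast
    ring
  rw [map_mul, ← Complex.exp_conj, hexp]
  simp only [map_mul, Complex.conj_I, Complex.conj_ofReal, map_intCast]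
  ring

theorem inner_chiSum_eq_integral [IsFiniteMeasure ν]
    (hwν : ∀ k l : ℤ, inner ℂ (w k) (w l) = ∫ t : ℝ, Complex.exp (Complex.I * (l - k : ℤ) * t) ∂ν)
    (t₁ t₂ t₃ t₄ : ℝ) (N M : ℕ) :
    inner ℂ (chiSum w t₁ t₂ N) (chiSum w t₃ t₄ M) =
      ∫ t, starRingEnd ℂ (chiPoly t₁ t₂ N t) * chiPoly t₃ t₄ M t ∂ν := by
  have hexp : ∀ (c : ℂ) (n : ℤ), Integrable (fun t : ℝ => c * Complex.exp (Complex.I * n * t)) ν :=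
    fun c n => (Integrable.of_bound (C := 1) (by fun_prop)
      (.of_forall fun t => (norm_exp_I_mul_int_mul n t).le)).const_mul c
  simp_rw [conj_chiPoly_mul_chiPoly]
  rw [integral_finsetSum _ fun k _ => integrable_finsetSum _ fun l _ => hexp _ _, chiSum, sum_inner]
  refine Finset.sum_congr rfl fun k _ => ?_
  rw [integral_finsetSum _ fun l _ => hexp _ _, chiSum, inner_sum]
  refine Finset.sum_congr rfl fun l _ => ?_
  rw [integral_const_mul, inner_smul_left, inner_smul_right, hwν, mul_assoc]

theorem tendsto_inner_chiSum [IsFiniteMeasure ν]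
    (hwν : ∀ k l : ℤ, inner ℂ (w k) (w l) = ∫ t : ℝ, Complex.exp (Complex.I * (l - k : ℤ) * t) ∂ν)
    (t₁ t₂ t₃ t₄ : ℝ) :
    Tendsto (fun p : ℕ × ℕ => inner ℂ (chiSum w t₁ t₂ p.1) (chiSum w t₃ t₄ p.2))
      (atTop ×ˢ atTop) (𝓝 (∫ t, ((chiLimit t₁ t₂ t * chiLimit t₃ t₄ t : ℝ) : ℂ) ∂ν)) := by
  simp_rw [inner_chiSum_eq_integral hwν]
  refine tendsto_integral_filter_of_norm_le_const (.of_forall fun p => ?_)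
    ⟨(|t₂ - t₁| / (2 * Real.pi) + 6 / Real.pi) * (|t₄ - t₃| / (2 * Real.pi) + 6 / Real.pi), ?_⟩
    (.of_forall fun t => ?_)
  · exact ((Complex.continuous_conj.comp (continuous_chiPoly t₁ t₂ p.1)).mul
      (continuous_chiPoly t₃ t₄ p.2)).aestronglyMeasurable
  · refine .of_forall fun p => .of_forall fun t => ?_
    rw [norm_mul, RCLike.norm_conj]
    exact mul_le_mul (norm_chiPoly_le _ _ _ _) (norm_chiPoly_le _ _ _ _) (norm_nonneg _)
      ((norm_nonneg _).trans (norm_chiPoly_le t₁ t₂ 0 t))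
  · rw [Complex.ofReal_mul, ← Complex.conj_ofReal (chiLimit t₁ t₂ t)]
    exact ((Complex.continuous_conj.tendsto _).comp
      ((tendsto_chiPoly t₁ t₂ t).comp tendsto_fst)).mul ((tendsto_chiPoly t₃ t₄ t).comp tendsto_snd)

theorem cauchySeq_of_tendsto_inner {x : ℕ → H} {L : ℂ}
    (h : Tendsto (fun p : ℕ × ℕ => inner ℂ (x p.1) (x p.2)) (atTop ×ˢ atTop) (𝓝 L)) :
    CauchySeq x := by
  have hre : ∀ {f g : ℕ × ℕ → ℕ}, Tendsto f (atTop ×ˢ atTop) atTop →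
      Tendsto g (atTop ×ˢ atTop) atTop →
      Tendsto (fun p => (inner ℂ (x (f p)) (x (g p))).re) (atTop ×ˢ atTop) (𝓝 L.re) :=
    fun hf hg => (Complex.continuous_re.tendsto L).comp (h.comp (hf.prodMk hg))
  have hsq : Tendsto (fun p : ℕ × ℕ => dist (x p.1) (x p.2) ^ 2) (atTop ×ˢ atTop) (𝓝 0) := by
    have hlim := ((hre tendsto_fst tendsto_fst).sub
      ((hre tendsto_fst tendsto_snd).const_mul 2)).add (hre tendsto_snd tendsto_snd)
    rw [show L.re - 2 * L.re + L.re = 0 by ring] at hlim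
    refine hlim.congr fun p => ?_
    rw [dist_eq_norm, @norm_sub_sq ℂ, @norm_sq_eq_re_inner ℂ, @norm_sq_eq_re_inner ℂ]
    rfl
  rw [cauchySeq_iff_tendsto_dist_atTop_0, ← prod_atTop_atTop_eq]
  simpa [Real.sqrt_sq dist_nonneg] using hsq.sqrt

theorem IsStationarySeq.cauchySeq_chiSum (hw : IsStationarySeq w) (t₁ t₂ : ℝ) :
    CauchySeq (chiSum w t₁ t₂) := by
  obtain ⟨ν, _, -, hwν⟩ := hw.exists_measure
  exact cauchySeq_of_tendsto_inner (tendsto_inner_chiSum hwν t₁ t₂ t₁ t₂)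

/-- The angles in `(-π, π]` that are charged by both of the (limit) indicators of the arcs
`[ϑ₁, ϑ₂]` and `[ϑ₃, ϑ₄]`. -/
def commonAngles (t₁ t₂ t₃ t₄ : ℝ) : Set ℝ :=
  {t ∈ Set.Ioc (-Real.pi) Real.pi | chiLimit t₁ t₂ t ≠ 0 ∧ chiLimit t₃ t₄ t ≠ 0}

theorem IsStationarySeq.inner_eq_zero_of_tendsto_chiSum (hw : IsStationarySeq w)
    {t₁ t₂ t₃ t₄ : ℝ} (hs : (commonAngles t₁ t₂ t₃ t₄).Countable)
    (hmass : ∀ τ ∈ commonAngles t₁ t₂ t₃ t₄,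
      Tendsto (cesaroMean (fun n => inner ℂ (w 0) (w n)) τ) atTop (𝓝 0))
    {x z : H} (hx : Tendsto (chiSum w t₁ t₂) atTop (𝓝 x))
    (hz : Tendsto (chiSum w t₃ t₄) atTop (𝓝 z)) : inner ℂ x z = 0 := by
  obtain ⟨ν, _, hν, hwν⟩ := hw.exists_measure
  have hnull : ν (commonAngles t₁ t₂ t₃ t₄) = 0 := by
    rw [← Set.biUnion_of_singleton (commonAngles t₁ t₂ t₃ t₄), measure_biUnion_null_iff hs]
    refine fun τ hτ => measure_singleton_eq_zero_of_tendsto_cesaroMean hν hτ.1 ?_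
    simpa only [hwν, sub_zero] using hmass τ hτ
  have hzero : ∫ t, ((chiLimit t₁ t₂ t * chiLimit t₃ t₄ t : ℝ) : ℂ) ∂ν = 0 := by
    refine integral_eq_zero_of_ae ?_
    filter_upwards [hν, measure_eq_zero_iff_ae_notMem.1 hnull] with t ht hts
    by_contra h
    exact hts ⟨ht, mul_ne_zero_iff.1 (Complex.ofReal_ne_zero.1 h)⟩
  have hlim := tendsto_inner_chiSum hwν t₁ t₂ t₃ t₄
  rw [hzero] at hlim
  exact tendsto_nhds_unique
    ((hx.comp tendsto_fst).inner (hz.comp tendsto_snd)) hlim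

theorem inner_eq_zero_of_forall_inner_add_smul {x x' z z' : H}
    (h : ∀ α : ℂ, inner ℂ (x + α • x') (z + α • z') = 0) : inner ℂ x z' = 0 := by
  have h₁ := h 1
  have h₂ := h (-1)
  have h₃ := h Complex.I
  have h₄ := h (-Complex.I)
  simp only [inner_add_left, inner_add_right, inner_smul_left, inner_smul_right, map_neg, map_one,
    Complex.conj_I] at h₁ h₂ h₃ h₄
  linear_combination (1 / 4 : ℂ) * (h₁ - h₂ - Complex.I * (h₃ - h₄)) +
    (1 / 2 : ℂ) * (inner ℂ x z' - inner ℂ x' z) * Complex.I_sq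

theorem chiSum_add_smul (u v : ℤ → H) (α : ℂ) (t₁ t₂ : ℝ) (N : ℕ) :
    chiSum (fun k => u k + α • v k) t₁ t₂ N = chiSum u t₁ t₂ N + α • chiSum v t₁ t₂ N := by
  simp only [chiSum, smul_add, Finset.sum_add_distrib, Finset.smul_sum, smul_comm α]

theorem cesaroMean_add (c d : ℤ → ℂ) (τ : ℝ) (N : ℕ) :
    cesaroMean (fun n => c n + d n) τ N = cesaroMean c τ N + cesaroMean d τ N := by
  simp only [cesaroMean, mul_add, Finset.sum_add_distrib]

theorem isStationarySeq_add_smul {ι : Type*} {U : ι → ℤ → H} {c : ι → ι → ℤ → ℂ}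
    (hU : ∀ i j k l, inner ℂ (U i k) (U j l) = c i j (l - k)) (i j : ι) (α : ℂ) :
    IsStationarySeq (fun k => U i k + α • U j k) := fun k l n => by
  simp only [inner_add_left, inner_add_right, inner_smul_left, inner_smul_right, hU,
    add_sub_add_right_eq_sub]

theorem tendsto_cesaroMean_inner_add_smul {ι : Type*} {U : ι → ℤ → H} {c : ι → ι → ℤ → ℂ}
    (hU : ∀ i j k l, inner ℂ (U i k) (U j l) = c i j (l - k)) {τ : ℝ}
    (hmass : ∀ i j, Tendsto (cesaroMean (c i j) τ) atTop (𝓝 0)) (i j : ι) (α : ℂ) :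
    Tendsto (cesaroMean (fun n => inner ℂ (U i 0 + α • U j 0) (U i n + α • U j n)) τ)
      atTop (𝓝 0) := by
  have hexpand : (fun n => inner ℂ (U i 0 + α • U j 0) (U i n + α • U j n)) = fun n =>
      (c i i n + α * c i j n) + (starRingEnd ℂ α * c j i n +
        starRingEnd ℂ α * α * c j j n) := by
    funext n
    simp only [inner_add_left, inner_add_right, inner_smul_left, inner_smul_right, hU, sub_zero]
    ring
  have hlim := ((hmass i i).add ((hmass i j).const_mul α)).add
    (((hmass j i).const_mul (starRingEnd ℂ α)).add
      ((hmass j j).const_mul (starRingEnd ℂ α * α)))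
  simp only [mul_zero, add_zero] at hlim
  refine hlim.congr fun N => ?_
  simp only [hexpand, cesaroMean_add, cesaroMean_const_mul]

theorem inner_eq_zero_of_tendsto_chiSum {ι : Type*} {U : ι → ℤ → H} {c : ι → ι → ℤ → ℂ}
    (hU : ∀ i j k l, inner ℂ (U i k) (U j l) = c i j (l - k)) {t₁ t₂ t₃ t₄ : ℝ}
    (hs : (commonAngles t₁ t₂ t₃ t₄).Countable)
    (hmass : ∀ τ ∈ commonAngles t₁ t₂ t₃ t₄, ∀ i j,
      Tendsto (cesaroMean (c i j) τ) atTop (𝓝 0))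
    {x z : ι → H} (hx : ∀ i, Tendsto (chiSum (U i) t₁ t₂) atTop (𝓝 (x i)))
    (hz : ∀ i, Tendsto (chiSum (U i) t₃ t₄) atTop (𝓝 (z i))) (i j : ι) :
    inner ℂ (x i) (z j) = 0 := by
  refine inner_eq_zero_of_forall_inner_add_smul (x' := x j) (z := z i) fun α => ?_
  refine (isStationarySeq_add_smul hU i j α).inner_eq_zero_of_tendsto_chiSum hs
    (fun τ hτ => tendsto_cesaroMean_inner_add_smul hU (hmass τ hτ) i j α) ?_ ?_
  · exact ((hx i).add ((hx j).const_smul α)).congr fun N => (chiSum_add_smul _ _ _ _ _ _).symm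
  · exact ((hz i).add ((hz j).const_smul α)).congr fun N => (chiSum_add_smul _ _ _ _ _ _).symm

end ChiSum

section GaussianLimits

variable {Ω : Type*} [MeasurableSpace Ω] {μ : Measure Ω}

/-- The expectation as a continuous linear functional on `L²(μ; 𝕜)`. -/
def expectationLp (𝕜 : Type*) [RCLike 𝕜] (μ : Measure Ω) [IsFiniteMeasure μ] :
    Lp 𝕜 2 μ →L[𝕜] 𝕜 :=
  innerSL 𝕜 (indicatorConstLp 2 MeasurableSet.univ (measure_ne_top μ _) 1)

theorem expectationLp_apply {𝕜 : Type*} [RCLike 𝕜] [IsFiniteMeasure μ] (f : Lp 𝕜 2 μ) :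
    expectationLp 𝕜 μ f = ∫ ω, f ω ∂μ := by
  rw [expectationLp, innerSL_apply_apply, L2.inner_indicatorConstLp_one, setIntegral_univ]

theorem continuous_variance_Lp_two [IsProbabilityMeasure μ] :
    Continuous fun f : Lp ℝ 2 μ => Var[f; μ] := by
  have hvar : ∀ f : Lp ℝ 2 μ, Var[f; μ] = inner ℝ f f - expectationLp ℝ μ f ^ 2 := fun f => by
    rw [variance_eq_sub (Lp.memLp f), L2.inner_def, expectationLp_apply]
    simp only [real_inner_self_eq_norm_sq, Real.norm_eq_abs, sq_abs, Pi.pow_apply]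
  simp_rw [hvar]
  exact (continuous_id.inner continuous_id).sub ((expectationLp ℝ μ).continuous.pow 2)

variable {E F : Type*} [NormedAddCommGroup E] [NormedSpace ℝ E] [MeasurableSpace E] [BorelSpace E]
  [NormedAddCommGroup F] [NormedSpace ℝ F] [MeasurableSpace F] [BorelSpace F]

theorem tendsto_charFunDual_map_of_tendsto_Lp [IsProbabilityMeasure μ] {X : ℕ → Lp E 2 μ}
    {x : Lp E 2 μ} (h : Tendsto X atTop (𝓝 x)) (L : StrongDual ℝ E) :
    Tendsto (fun n => charFunDual (μ.map (X n)) L) atTop (𝓝 (charFunDual (μ.map x) L)) := by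
  have hdist := (tendstoInMeasure_of_tendsto_Lp h).tendstoInDistribution fun n =>
    (Lp.aestronglyMeasurable (X n)).aemeasurable
  exact (ProbabilityMeasure.tendsto_iff_forall_integral_rclike_tendsto ℂ).1 hdist.tendsto
    (BoundedContinuousFunction.probCharDual L)

theorem hasGaussianLaw_of_tendsto_Lp [IsProbabilityMeasure μ] {X : ℕ → Lp E 2 μ} {x : Lp E 2 μ}
    (hX : ∀ n, HasGaussianLaw (X n) μ) (h : Tendsto X atTop (𝓝 x)) : HasGaussianLaw x μ := by
  refine (hasGaussianLaw_iff_charFunDual_map_eq (Lp.aestronglyMeasurable x).aemeasurable).2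
    fun L => tendsto_nhds_unique (tendsto_charFunDual_map_of_tendsto_Lp h L) ?_
  have hL : Tendsto (fun n => L.compLp (X n)) atTop (𝓝 (L.compLp x)) :=
    ((L.compLpL 2 μ).continuous.tendsto x).comp h
  have hmean := ((expectationLp ℝ μ).continuous.tendsto _).comp hL
  have hvar := (continuous_variance_Lp_two.tendsto _).comp hL
  simp only [Function.comp_def, expectationLp_apply, integral_congr_ae (L.coeFn_compLp _),
    variance_congr (L.coeFn_compLp _)] at hmean hvar
  simp_rw [fun n => (hX n).charFunDual_map_eq L]
  exact ((hmean.ofReal.mul_const _).sub (hvar.ofReal.div_const _)).cexp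

theorem hasGaussianLaw_prodMk_of_tendsto_Lp [SecondCountableTopologyEither E F]
    [IsProbabilityMeasure μ] {X : ℕ → Lp E 2 μ} {Y : ℕ → Lp F 2 μ} {x : Lp E 2 μ} {y : Lp F 2 μ}
    (hXY : ∀ n, HasGaussianLaw (fun ω => (X n ω, Y n ω)) μ) (hX : Tendsto X atTop (𝓝 x))
    (hY : Tendsto Y atTop (𝓝 y)) : HasGaussianLaw (fun ω => (x ω, y ω)) μ := by
  let J₁ := (ContinuousLinearMap.inl ℝ E F).compLpL 2 μ
  let J₂ := (ContinuousLinearMap.inr ℝ E F).compLpL 2 μ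
  have hpair : ∀ f g, (J₁ f + J₂ g : Lp (E × F) 2 μ) =ᵐ[μ] fun ω => (f ω, g ω) := fun f g => by
    filter_upwards [Lp.coeFn_add (J₁ f) (J₂ g), (ContinuousLinearMap.inl ℝ E F).coeFn_compLpL f,
      (ContinuousLinearMap.inr ℝ E F).coeFn_compLpL g] with ω hadd hinl hinr
    rw [hadd, Pi.add_apply, hinl, hinr]
    simp only [ContinuousLinearMap.inl_apply, ContinuousLinearMap.inr_apply, Prod.mk_add_mk,
      add_zero, zero_add]
  exact (hasGaussianLaw_of_tendsto_Lp (fun n => (hXY n).congr (hpair _ _).symm)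
    (((J₁.continuous.tendsto x).comp hX).add ((J₂.continuous.tendsto y).comp hY))).congr
    (hpair x y)

end GaussianLimits

section ProcessInL2

variable {Ω : Type*} [MeasurableSpace Ω] {m : ℕ} {μ : Measure Ω}
  {y : ℤ → Ω → EuclideanSpace ℝ (Fin m)} {t₁ t₂ t₃ t₄ : ℝ} {Z Z' : Ω → EuclideanSpace ℂ (Fin m)}

/-- The inclusion of `ℝ^m` into `ℂ^m`. -/
def complexify (m : ℕ) : EuclideanSpace ℝ (Fin m) →L[ℝ] EuclideanSpace ℂ (Fin m) :=
  LinearMap.toContinuousLinearMap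
    { toFun := fun x => WithLp.toLp 2 fun i => (x i : ℂ)
      map_add' := fun x x' => by ext i; simp
      map_smul' := fun r x => by ext i; simp }

theorem memLp_complexify (hy : IsGaussianProcess y μ) (k : ℤ) :
    MemLp (fun ω => complexify m (y k ω)) 2 μ :=
  (complexify m).comp_memLp' (hy.hasGaussianLaw_eval k).memLp_two

/-- The process as a sequence in the Hilbert space `L²(μ; ℂ^m)`, where the mean-square limits
are taken. -/
def processLp (hy : IsGaussianProcess y μ) (k : ℤ) : Lp (EuclideanSpace ℂ (Fin m)) 2 μ :=
  (memLp_complexify hy k).toLp _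

/-- The `i`-th component of a random vector in `L²`. -/
def coordLp (μ : Measure Ω) (i : Fin m) :
    Lp (EuclideanSpace ℂ (Fin m)) 2 μ →L[ℂ] Lp ℂ 2 μ :=
  (EuclideanSpace.proj i : EuclideanSpace ℂ (Fin m) →L[ℂ] ℂ).compLpL 2 μ

theorem coordLp_ae_eq (i : Fin m) (f : Lp (EuclideanSpace ℂ (Fin m)) 2 μ) :
    coordLp μ i f =ᵐ[μ] fun ω => f ω i :=
  (EuclideanSpace.proj i : EuclideanSpace ℂ (Fin m) →L[ℂ] ℂ).coeFn_compLpL f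

theorem inner_coordLp (f g : Lp (EuclideanSpace ℂ (Fin m)) 2 μ) (i j : Fin m) :
    inner ℂ (coordLp μ i f) (coordLp μ j g) = ∫ ω, starRingEnd ℂ (f ω i) * g ω j ∂μ := by
  rw [L2.inner_def]
  refine integral_congr_ae ?_
  filter_upwards [coordLp_ae_eq i f, coordLp_ae_eq j g] with ω hf hg
  rw [hf, hg, RCLike.inner_apply']

theorem inner_eq_sum_inner_coordLp (f g : Lp (EuclideanSpace ℂ (Fin m)) 2 μ) :
    inner ℂ f g = ∑ i, inner ℂ (coordLp μ i f) (coordLp μ i g) := by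
  simp only [L2.inner_def]
  rw [← integral_finsetSum _ fun i _ => L2.integrable_inner _ _]
  refine integral_congr_ae ?_
  filter_upwards [ae_all_iff.2 fun i => coordLp_ae_eq i f, ae_all_iff.2 fun i => coordLp_ae_eq i g]
    with ω hf hg
  simp only [PiLp.inner_apply, hf, hg]

theorem inner_coordLp_processLp (hy : IsStationaryGaussian μ y) (i j : Fin m) (k l : ℤ) :
    inner ℂ (coordLp μ i (processLp hy.gaussian k)) (coordLp μ j (processLp hy.gaussian l)) =
      (covLag μ y (l - k) j i : ℂ) := by
  have hstat := hy.stationary k (l - k) j i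
  rw [add_sub_cancel] at hstat
  rw [inner_coordLp, covLag, Matrix.of_apply, ← hstat, ← integral_complex_ofReal]
  refine integral_congr_ae ?_
  filter_upwards [(memLp_complexify hy.gaussian k).coeFn_toLp,
    (memLp_complexify hy.gaussian l).coeFn_toLp] with ω hk hl
  rw [processLp, processLp, hk, hl]
  simp [complexify, mul_comm]

theorem isStationarySeq_processLp (hy : IsStationaryGaussian μ y) :
    IsStationarySeq (processLp hy.gaussian) := fun k l n => by
  simp only [inner_eq_sum_inner_coordLp, inner_coordLp_processLp hy, add_sub_add_right_eq_sub]

theorem map_chiSum {E E' : Type*} [AddCommGroup E] [Module ℂ E] [AddCommGroup E'] [Module ℂ E']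
    (L : E →ₗ[ℂ] E') (w : ℤ → E) (t₁ t₂ : ℝ) (N : ℕ) :
    L (chiSum w t₁ t₂ N) = chiSum (fun k => L (w k)) t₁ t₂ N := by
  simp only [chiSum, map_sum, map_smul]

theorem hasGaussianLaw_partialSum_prodMk (hy : IsGaussianProcess y μ) (t₁ t₂ t₃ t₄ : ℝ)
    (N : ℕ) :
    HasGaussianLaw (fun ω => (partialSum y t₁ t₂ N ω, partialSum y t₃ t₄ N ω)) μ := by
  let S (s₁ s₂ : ℝ) : (Finset.Icc (-(N : ℤ)) N → EuclideanSpace ℝ (Fin m)) →L[ℝ]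
      EuclideanSpace ℂ (Fin m) :=
    ∑ k : Finset.Icc (-(N : ℤ)) N,
      chi k s₁ s₂ • (complexify m).comp (ContinuousLinearMap.proj k)
  have hS : ∀ s₁ s₂ ω, S s₁ s₂ (fun k => y k ω) = partialSum y s₁ s₂ N ω := fun s₁ s₂ ω => by
    rw [partialSum, ← Finset.sum_coe_sort]
    simp only [S, _root_.sum_apply]
    rfl
  simp_rw [← hS]
  exact (hy.hasGaussianLaw (Finset.Icc (-(N : ℤ)) N)).map_fun ((S t₁ t₂).prod (S t₃ t₄))

theorem memLp_partialSum (hy : IsGaussianProcess y μ) (t₁ t₂ : ℝ) (N : ℕ) :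
    MemLp (partialSum y t₁ t₂ N) 2 μ :=
  (hasGaussianLaw_partialSum_prodMk hy t₁ t₂ t₁ t₂ N).fst.memLp_two

theorem chiSum_processLp (hy : IsGaussianProcess y μ) (t₁ t₂ : ℝ) (N : ℕ) :
    chiSum (processLp hy) t₁ t₂ N = (memLp_partialSum hy t₁ t₂ N).toLp _ := by
  refine Lp.ext ?_
  filter_upwards [ae_all_iff.2 fun k => Lp.coeFn_smul (chi k t₁ t₂) (processLp hy k),
    ae_all_iff.2 fun k => (memLp_complexify hy k).coeFn_toLp,
    Lp.coeFn_finsetSum (Finset.Icc (-(N : ℤ)) N) (fun k => chi k t₁ t₂ • processLp hy k),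
    (memLp_partialSum hy t₁ t₂ N).coeFn_toLp] with ω hsmul hproc hsum hpartial
  rw [hpartial, partialSum, chiSum, hsum, Finset.sum_apply]
  refine Finset.sum_congr rfl fun k _ => ?_
  rw [hsmul, Pi.smul_apply, processLp, hproc]
  rfl

theorem isSpectralIncrement_iff_tendsto_chiSum (hy : IsGaussianProcess y μ) :
    IsSpectralIncrement μ y t₁ t₂ Z ↔
      ∃ hZ : MemLp Z 2 μ, Tendsto (chiSum (processLp hy) t₁ t₂) atTop (𝓝 (hZ.toLp Z)) := by
  have hiff : ∀ hZ : MemLp Z 2 μ, Tendsto (chiSum (processLp hy) t₁ t₂) atTop (𝓝 (hZ.toLp Z)) ↔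
      Tendsto (fun N => eLpNorm (fun ω => partialSum y t₁ t₂ N ω - Z ω) 2 μ) atTop (𝓝 0) :=
    fun hZ => by
      rw [funext fun N => chiSum_processLp hy t₁ t₂ N]
      exact Lp.tendsto_Lp_iff_tendsto_eLpNorm'' _ (memLp_partialSum hy t₁ t₂) Z hZ
  exact ⟨fun h => ⟨h.memLp, (hiff h.memLp).2 h.tendsto⟩, fun ⟨hZ, h⟩ => ⟨hZ, (hiff hZ).1 h⟩⟩

theorem exists_isSpectralIncrement (hy : IsStationaryGaussian μ y) (t₁ t₂ : ℝ) :
    ∃ Z, IsSpectralIncrement μ y t₁ t₂ Z := by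
  obtain ⟨W, hW⟩ := cauchySeq_tendsto_of_complete
    ((isStationarySeq_processLp hy).cauchySeq_chiSum t₁ t₂)
  exact ⟨W, (isSpectralIncrement_iff_tendsto_chiSum hy.gaussian).2
    ⟨Lp.memLp W, by rwa [Lp.toLp_coeFn]⟩⟩

theorem isSpectralIncrement_yhat (hy : IsStationaryGaussian μ y) (t₁ t₂ : ℝ) :
    IsSpectralIncrement μ y t₁ t₂ (yhat μ y t₁ t₂) := by
  rw [yhat, dif_pos (exists_isSpectralIncrement hy t₁ t₂)]
  exact (exists_isSpectralIncrement hy t₁ t₂).choose_spec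

theorem IsSpectralIncrement.ae_eq (hy : IsGaussianProcess y μ)
    (hZ : IsSpectralIncrement μ y t₁ t₂ Z) (hZ' : IsSpectralIncrement μ y t₁ t₂ Z') :
    Z =ᵐ[μ] Z' := by
  obtain ⟨hmem, hlim⟩ := (isSpectralIncrement_iff_tendsto_chiSum hy).1 hZ
  obtain ⟨hmem', hlim'⟩ := (isSpectralIncrement_iff_tendsto_chiSum hy).1 hZ'
  exact (MemLp.toLp_eq_toLp_iff hmem hmem').1 (tendsto_nhds_unique hlim hlim')

/-- Componentwise complex conjugation on `ℂ^m`. -/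
def conjVec (m : ℕ) : EuclideanSpace ℂ (Fin m) ≃ₗᵢ[ℝ] EuclideanSpace ℂ (Fin m) :=
  LinearIsometryEquiv.piLpCongrRight 2 fun _ => Complex.conjLIE

omit [MeasurableSpace Ω] in
theorem partialSum_neg_neg (t₁ t₂ : ℝ) (N : ℕ) (ω : Ω) :
    partialSum y (-t₂) (-t₁) N ω = conjVec m (partialSum y t₁ t₂ N ω) := by
  ext i
  simp [partialSum, conjVec, conj_chi]

theorem IsSpectralIncrement.conj (hZ : IsSpectralIncrement μ y t₁ t₂ Z) :
    IsSpectralIncrement μ y (-t₂) (-t₁) (fun ω => conjVec m (Z ω)) where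
  memLp := (conjVec m).toContinuousLinearEquiv.toContinuousLinearMap.comp_memLp' hZ.memLp
  tendsto := hZ.tendsto.congr fun N => eLpNorm_congr_norm_ae <| .of_forall fun ω => by
    rw [partialSum_neg_neg, ← map_sub, LinearIsometryEquiv.norm_map]

theorem hasGaussianLaw_prodMk_of_isSpectralIncrement (hy : IsGaussianProcess y μ)
    (hZ : IsSpectralIncrement μ y t₁ t₂ Z) (hZ' : IsSpectralIncrement μ y t₃ t₄ Z') :
    HasGaussianLaw (fun ω => (Z ω, Z' ω)) μ := by
  have := (hy.hasGaussianLaw_eval 0).isProbabilityMeasure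
  obtain ⟨hmem, hlim⟩ := (isSpectralIncrement_iff_tendsto_chiSum hy).1 hZ
  obtain ⟨hmem', hlim'⟩ := (isSpectralIncrement_iff_tendsto_chiSum hy).1 hZ'
  have hsum : ∀ s₁ s₂ N, ⇑(chiSum (processLp hy) s₁ s₂ N) =ᵐ[μ] partialSum y s₁ s₂ N :=
    fun s₁ s₂ N => chiSum_processLp hy s₁ s₂ N ▸ (memLp_partialSum hy s₁ s₂ N).coeFn_toLp
  exact (hasGaussianLaw_prodMk_of_tendsto_Lp
    (fun N => (hasGaussianLaw_partialSum_prodMk hy t₁ t₂ t₃ t₄ N).congr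
      ((hsum t₁ t₂ N).prodMk (hsum t₃ t₄ N)).symm) hlim hlim').congr
    (hmem.coeFn_toLp.prodMk hmem'.coeFn_toLp)

theorem IsSpectralIncrement.tendsto_chiSum_coordLp (hy : IsGaussianProcess y μ)
    (hZ : IsSpectralIncrement μ y t₁ t₂ Z) (i : Fin m) :
    Tendsto (chiSum (fun k => coordLp μ i (processLp hy k)) t₁ t₂) atTop
      (𝓝 (coordLp μ i (hZ.memLp.toLp Z))) := by
  obtain ⟨hmem, hlim⟩ := (isSpectralIncrement_iff_tendsto_chiSum hy).1 hZ
  exact (((coordLp μ i).continuous.tendsto _).comp hlim).congr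
    (map_chiSum (coordLp μ i).toLinearMap _ t₁ t₂)

theorem expectationLp_coordLp [IsFiniteMeasure μ] {f : Ω → EuclideanSpace ℂ (Fin m)}
    (hf : MemLp f 2 μ) (i : Fin m) :
    expectationLp ℂ μ (coordLp μ i (hf.toLp f)) = ∫ ω, f ω i ∂μ := by
  rw [expectationLp_apply]
  refine integral_congr_ae ?_
  filter_upwards [coordLp_ae_eq i (hf.toLp f), hf.coeFn_toLp] with ω hcoord hω
  rw [hcoord, hω]

theorem expectationLp_coordLp_processLp [IsFiniteMeasure μ] (hy : IsStationaryGaussian μ y)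
    (k : ℤ) (i : Fin m) : expectationLp ℂ μ (coordLp μ i (processLp hy.gaussian k)) = 0 := by
  rw [processLp, expectationLp_coordLp]
  exact integral_complex_ofReal.trans (by rw [hy.mean_zero, Complex.ofReal_zero])

theorem IsSpectralIncrement.integral_eq_zero (hy : IsStationaryGaussian μ y)
    (hZ : IsSpectralIncrement μ y t₁ t₂ Z) (i : Fin m) : ∫ ω, Z ω i ∂μ = 0 := by
  have := (hy.gaussian.hasGaussianLaw_eval 0).isProbabilityMeasure
  have hlim := ((expectationLp ℂ μ).continuous.tendsto _).comp
    (hZ.tendsto_chiSum_coordLp hy.gaussian i)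
  rw [expectationLp_coordLp] at hlim
  refine tendsto_nhds_unique hlim (tendsto_const_nhds.congr fun N => ?_)
  simp [chiSum, expectationLp_coordLp_processLp hy]

/-- The increments over `(ϑ₁, ϑ₂)` and `(ϑ₃, ϑ₄)` share no spectral mass: their limiting
coefficient functions overlap in at most countably many frequencies, none of them an atom of the
spectral measure. -/
def SpectrallyDisjoint (μ : Measure Ω) (y : ℤ → Ω → EuclideanSpace ℝ (Fin m))
    (t₁ t₂ t₃ t₄ : ℝ) : Prop :=
  (commonAngles t₁ t₂ t₃ t₄).Countable ∧ ∀ τ ∈ commonAngles t₁ t₂ t₃ t₄, NoSpectralMassAt μ y τ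

theorem IsSpectralIncrement.integral_conj_mul_eq_zero (hy : IsStationaryGaussian μ y)
    (hZ : IsSpectralIncrement μ y t₁ t₂ Z) (hZ' : IsSpectralIncrement μ y t₃ t₄ Z')
    (hdisj : SpectrallyDisjoint μ y t₁ t₂ t₃ t₄) (i j : Fin m) :
    ∫ ω, starRingEnd ℂ (Z ω i) * Z' ω j ∂μ = 0 := by
  have hinner := inner_eq_zero_of_tendsto_chiSum (c := fun i j n => (covLag μ y n j i : ℂ))
    (inner_coordLp_processLp hy) hdisj.1
    (fun τ hτ i j => (hdisj.2 τ hτ).tendsto_cesaroMean hτ.1 j i)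
    (hZ.tendsto_chiSum_coordLp hy.gaussian) (hZ'.tendsto_chiSum_coordLp hy.gaussian) i j
  rw [inner_coordLp] at hinner
  rw [← hinner]
  refine integral_congr_ae ?_
  filter_upwards [hZ.memLp.coeFn_toLp, hZ'.memLp.coeFn_toLp] with ω hω hω'
  rw [hω, hω']

end ProcessInL2

section Independence

variable {Ω : Type*} [MeasurableSpace Ω] {μ : Measure Ω}

theorem re_mul_re_eq (z w : ℂ) : z.re * w.re = (z * w + starRingEnd ℂ z * w).re / 2 := by
  simp only [Complex.add_re, Complex.mul_re, Complex.conj_re, Complex.conj_im]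
  ring

theorem memLp_re_mul {f : Ω → ℂ} (hf : MemLp f 2 μ) (a : ℂ) :
    MemLp (fun ω => (f ω * a).re) 2 μ :=
  (hf.mul_const a).re

theorem covariance_re_mul_eq_zero [IsProbabilityMeasure μ] {f g : Ω → ℂ} (hf : MemLp f 2 μ)
    (hg : MemLp g 2 μ) (hmean : ∫ ω, f ω ∂μ = 0) (hmul : ∫ ω, f ω * g ω ∂μ = 0)
    (hconj : ∫ ω, starRingEnd ℂ (f ω) * g ω ∂μ = 0) (a b : ℂ) :
    cov[fun ω => (f ω * a).re, fun ω => (g ω * b).re; μ] = 0 := by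
  have hint : Integrable (fun ω => f ω * g ω * (a * b)) μ := (hf.integrable_mul hg).mul_const _
  have hint' : Integrable (fun ω => starRingEnd ℂ (f ω) * g ω * (starRingEnd ℂ a * b)) μ :=
    (hf.star.integrable_mul hg).mul_const _
  have hre : ∀ h : Ω → ℂ, Integrable h μ → ∫ ω, (h ω).re ∂μ = (∫ ω, h ω ∂μ).re :=
    fun h hh => integral_re hh
  have hprod : ∀ ω, (f ω * a).re * (g ω * b).re =
      (f ω * g ω * (a * b) + starRingEnd ℂ (f ω) * g ω * (starRingEnd ℂ a * b)).re / 2 :=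
    fun ω => by
      rw [re_mul_re_eq, map_mul]
      ring_nf
  rw [covariance_eq_sub (memLp_re_mul hf a) (memLp_re_mul hg b)]
  simp only [Pi.mul_apply, hprod]
  rw [integral_div, hre _ (hint.fun_add hint'), integral_add hint hint', integral_mul_const,
    integral_mul_const, hmul, hconj, hre _ ((hf.integrable one_le_two).mul_const a),
    integral_mul_const, hmean]
  simp

theorem indepFun_of_integral_mul_eq_zero {ι κ : Type*} [Finite ι] [Finite κ]
    {X : Ω → EuclideanSpace ℂ ι} {Y : Ω → EuclideanSpace ℂ κ}
    (hXY : HasGaussianLaw (fun ω => (X ω, Y ω)) μ) (hmean : ∀ i, ∫ ω, X ω i ∂μ = 0)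
    (hmul : ∀ i j, ∫ ω, X ω i * Y ω j ∂μ = 0)
    (hconj : ∀ i j, ∫ ω, starRingEnd ℂ (X ω i) * Y ω j ∂μ = 0) : IndepFun X Y μ := by
  have := hXY.isProbabilityMeasure
  cases nonempty_fintype ι
  cases nonempty_fintype κ
  have hX : ∀ i, MemLp (fun ω => X ω i) 2 μ := fun i =>
    (EuclideanSpace.proj i : EuclideanSpace ℂ ι →L[ℂ] ℂ).comp_memLp' hXY.fst.memLp_two
  have hY : ∀ j, MemLp (fun ω => Y ω j) 2 μ := fun j =>
    (EuclideanSpace.proj j : EuclideanSpace ℂ κ →L[ℂ] ℂ).comp_memLp' hXY.snd.memLp_two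
  refine hXY.indepFun_of_covariance_inner fun x y => ?_
  simp only [PiLp.inner_apply, Complex.inner]
  rw [covariance_fun_sum_fun_sum (fun i => memLp_re_mul (hX i) _)
    (fun j => memLp_re_mul (hY j) _)]
  exact Finset.sum_eq_zero fun i _ => Finset.sum_eq_zero fun j _ =>
    covariance_re_mul_eq_zero (hX i) (hY j) (hmean i) (hmul i j) (hconj i j) _ _

end Independence

section SpectralIncrements

variable {Ω : Type*} [MeasurableSpace Ω] {m : ℕ} {μ : Measure Ω}
  {y : ℤ → Ω → EuclideanSpace ℝ (Fin m)} {t₁ t₂ t₃ t₄ : ℝ} {Z Z' : Ω → EuclideanSpace ℂ (Fin m)}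

theorem IsSpectralIncrement.integral_mul_eq_zero (hy : IsStationaryGaussian μ y)
    (hZ : IsSpectralIncrement μ y t₁ t₂ Z) (hZ' : IsSpectralIncrement μ y t₃ t₄ Z')
    (hdisj : SpectrallyDisjoint μ y (-t₂) (-t₁) t₃ t₄) (i j : Fin m) :
    ∫ ω, Z ω i * Z' ω j ∂μ = 0 := by
  simpa [conjVec] using hZ.conj.integral_conj_mul_eq_zero hy hZ' hdisj i j

theorem IsSpectralIncrement.isCircularlySymmetricGaussian (hy : IsStationaryGaussian μ y)
    (hZ : IsSpectralIncrement μ y t₁ t₂ Z)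
    (hdisj : SpectrallyDisjoint μ y (-t₂) (-t₁) t₁ t₂) : IsCircularlySymmetricGaussian μ Z where
  gaussian :=
    (hasGaussianLaw_prodMk_of_isSpectralIncrement hy.gaussian hZ hZ).fst.map_fun
      ((ContinuousLinearMap.pi fun i => Complex.reCLM.comp
        ((EuclideanSpace.proj i : EuclideanSpace ℂ (Fin m) →L[ℂ] ℂ).restrictScalars ℝ)).prod
      (ContinuousLinearMap.pi fun i => Complex.imCLM.comp
        ((EuclideanSpace.proj i : EuclideanSpace ℂ (Fin m) →L[ℂ] ℂ).restrictScalars ℝ)))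
  mean_zero := hZ.integral_eq_zero hy
  pseudoCov_zero := hZ.integral_mul_eq_zero hy hZ hdisj

theorem IsSpectralIncrement.indepFun (hy : IsStationaryGaussian μ y)
    (hZ : IsSpectralIncrement μ y t₁ t₂ Z) (hZ' : IsSpectralIncrement μ y t₃ t₄ Z')
    (hdisj : SpectrallyDisjoint μ y t₁ t₂ t₃ t₄)
    (hdisj' : SpectrallyDisjoint μ y (-t₂) (-t₁) t₃ t₄) : IndepFun Z Z' μ :=
  indepFun_of_integral_mul_eq_zero
    (hasGaussianLaw_prodMk_of_isSpectralIncrement hy.gaussian hZ hZ')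
    (hZ.integral_eq_zero hy) (hZ.integral_mul_eq_zero hy hZ' hdisj')
    (hZ.integral_conj_mul_eq_zero hy hZ' hdisj)

theorem exists_cos_eq_of_chiLimit_ne_zero {t : ℝ} (h : chiLimit t₁ t₂ t ≠ 0) :
    ∃ s ∈ Set.uIcc t₁ t₂, Real.cos t = Real.cos s := by
  obtain ⟨s, hs, n, rfl⟩ := exists_mem_uIcc_of_chiLimit_ne_zero h
  exact ⟨s, hs, Real.cos_add_int_mul_two_pi s n⟩

theorem spectrallyDisjoint_of_cos_ne
    (h : ∀ s ∈ Set.uIcc t₁ t₂, ∀ s' ∈ Set.uIcc t₃ t₄, Real.cos s ≠ Real.cos s') :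
    SpectrallyDisjoint μ y t₁ t₂ t₃ t₄ := by
  have hempty : commonAngles t₁ t₂ t₃ t₄ = ∅ := by
    refine Set.eq_empty_of_forall_notMem fun τ hτ => ?_
    obtain ⟨s, hs, hcos⟩ := exists_cos_eq_of_chiLimit_ne_zero hτ.2.1
    obtain ⟨s', hs', hcos'⟩ := exists_cos_eq_of_chiLimit_ne_zero hτ.2.2
    exact h s hs s' hs' (hcos.symm.trans hcos')
  rw [SpectrallyDisjoint, hempty]
  exact ⟨Set.countable_empty, fun _ hτ => hτ.elim⟩

theorem neg_mem_uIcc_of_mem_uIcc_neg {s : ℝ} (hs : s ∈ Set.uIcc (-t₂) (-t₁)) :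
    -s ∈ Set.uIcc t₁ t₂ := by
  rwa [Set.uIcc_comm, ← Set.mem_neg, Set.neg_uIcc]

theorem eq_of_mem_uIcc_of_mem_Icc {a b s : ℝ} (h₁ : t₁ ∈ Set.Icc a b) (h₂ : t₂ ∈ Set.Icc a b)
    (hs : s ∈ Set.uIcc t₁ t₂) (hab : s = a ∨ s = b) : s = t₁ ∨ s = t₂ := by
  obtain hs | hs := Set.mem_uIcc.1 hs <;> grind

/-- A frequency common to the arc from `ϑ₁` to `ϑ₂` and to its mirror image is `s` and `-s'` modulo
`2π` with `s`, `s'` in `[kπ, (k + 1)π]`; then `s + s'` is a multiple of `2π`, which leaves only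
the endpoints. -/
theorem sin_eq_zero_and_cos_eq_of_mem_commonAngles {k : ℤ} {τ : ℝ}
    (h₁ : t₁ ∈ Set.Icc (k * Real.pi) ((k + 1) * Real.pi))
    (h₂ : t₂ ∈ Set.Icc (k * Real.pi) ((k + 1) * Real.pi))
    (hτ : τ ∈ commonAngles (-t₂) (-t₁) t₁ t₂) :
    Real.sin τ = 0 ∧ (Real.cos τ = Real.cos t₁ ∨ Real.cos τ = Real.cos t₂) := by
  obtain ⟨s', hs', n', hn'⟩ := exists_mem_uIcc_of_chiLimit_ne_zero hτ.2.1
  obtain ⟨s, hs, n, rfl⟩ := exists_mem_uIcc_of_chiLimit_ne_zero hτ.2.2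
  obtain ⟨hsk, hsk'⟩ := Set.uIcc_subset_Icc h₁ h₂ hs
  obtain ⟨hs'k, hs'k'⟩ := Set.uIcc_subset_Icc h₁ h₂ (neg_mem_uIcc_of_mem_uIcc_neg hs')
  have hsum : s - s' = ((n' - n : ℤ) : ℝ) * (2 * Real.pi) := by push_cast; linarith
  have hlower : (k : ℝ) ≤ (n' - n : ℤ) := le_of_mul_le_mul_right (by linarith) Real.two_pi_pos
  have hupper : ((n' - n : ℤ) : ℝ) ≤ (k + 1 : ℤ) :=
    le_of_mul_le_mul_right (by push_cast; push_cast at hsum; linarith) Real.two_pi_pos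
  have hend : s = k * Real.pi ∨ s = (k + 1) * Real.pi := by
    have hcases : n' - n = k ∨ n' - n = k + 1 := by
      have := Int.cast_le.1 hlower
      have := Int.cast_le.1 hupper
      omega
    rcases hcases with h | h <;> rw [h] at hsum
    · left; linarith
    · right; push_cast at hsum; linarith
  rw [Real.sin_add_int_mul_two_pi, Real.cos_add_int_mul_two_pi]
  refine ⟨?_, (eq_of_mem_uIcc_of_mem_Icc h₁ h₂ hs hend).imp (congrArg _) (congrArg _)⟩
  obtain rfl | rfl := hend
  · exact Real.sin_int_mul_pi k
  · exact_mod_cast Real.sin_int_mul_pi (k + 1)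

theorem spectrallyDisjoint_neg_of_mem_Icc {k : ℤ}
    (h₁ : t₁ ∈ Set.Icc (k * Real.pi) ((k + 1) * Real.pi))
    (h₂ : t₂ ∈ Set.Icc (k * Real.pi) ((k + 1) * Real.pi))
    (hmass : t₁ ≠ t₂ → ∀ τ ∈ Set.Ioc (-Real.pi) Real.pi, Real.sin τ = 0 →
      Real.cos τ = Real.cos t₁ ∨ Real.cos τ = Real.cos t₂ → NoSpectralMassAt μ y τ) :
    SpectrallyDisjoint μ y (-t₂) (-t₁) t₁ t₂ := by
  refine ⟨?_, fun τ hτ => ?_⟩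
  · refine (Set.countable_range fun n : ℤ => (n : ℝ) * Real.pi).mono fun τ hτ => ?_
    exact Real.sin_eq_zero_iff.1 (sin_eq_zero_and_cos_eq_of_mem_commonAngles h₁ h₂ hτ).1
  · have hne : t₁ ≠ t₂ := fun h => hτ.2.2 (by rw [h, chiLimit_self])
    obtain ⟨hsin, hcos⟩ := sin_eq_zero_and_cos_eq_of_mem_commonAngles h₁ h₂ hτ
    exact hmass hne τ hτ.1 hsin hcos

end SpectralIncrements

section Angles

theorem eq_or_eq_neg_of_cos_eq_cos {s t : ℝ} (hs : s ∈ Set.Icc (-Real.pi) Real.pi)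
    (ht : t ∈ Set.Icc (-Real.pi) Real.pi) (h : Real.cos s = Real.cos t) : s = t ∨ s = -t := by
  rw [← Real.cos_abs s, ← Real.cos_abs t] at h
  exact abs_eq_abs.1 (Real.injOn_cos ⟨abs_nonneg s, abs_le.2 hs⟩ ⟨abs_nonneg t, abs_le.2 ht⟩ h)

theorem cos_ne_cos_of_Icc_inter_eq_empty {t₁ t₂ t₃ t₄ : ℝ} (h₁₂ : t₁ ≤ t₂) (h₃₄ : t₃ ≤ t₄)
    (h₁ : -Real.pi ≤ t₁) (h₂ : t₂ ≤ Real.pi) (h₃ : -Real.pi ≤ t₃) (h₄ : t₄ ≤ Real.pi)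
    (h : Set.Icc t₁ t₂ ∩ Set.Icc t₃ t₄ = ∅) (h' : Set.Icc t₁ t₂ ∩ Set.Icc (-t₄) (-t₃) = ∅) :
    ∀ s ∈ Set.uIcc t₁ t₂, ∀ s' ∈ Set.uIcc t₃ t₄, Real.cos s ≠ Real.cos s' := by
  rw [Set.uIcc_of_le h₁₂, Set.uIcc_of_le h₃₄]
  intro s hs s' hs' hcos
  obtain rfl | rfl := eq_or_eq_neg_of_cos_eq_cos (Set.Icc_subset_Icc h₁ h₂ hs)
    (Set.Icc_subset_Icc h₃ h₄ hs') hcos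
  · exact h.le ⟨hs, hs'⟩
  · exact h'.le ⟨hs, neg_le_neg hs'.2, neg_le_neg hs'.1⟩

theorem exists_mem_Icc_int_mul_pi_of_same_sign {t₁ t₂ : ℝ}
    (h₁ : t₁ ∈ Set.Ioc (-Real.pi) Real.pi) (h₂ : t₂ ∈ Set.Ioc (-Real.pi) Real.pi)
    (h : (0 ≤ t₁ ∧ 0 ≤ t₂) ∨ (t₁ ≤ 0 ∧ t₂ ≤ 0)) :
    ∃ k : ℤ, t₁ ∈ Set.Icc (k * Real.pi) ((k + 1) * Real.pi) ∧
      t₂ ∈ Set.Icc (k * Real.pi) ((k + 1) * Real.pi) := by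
  obtain ⟨h₁', h₂'⟩ | ⟨h₁', h₂'⟩ := h
  · exact ⟨0, by simpa using ⟨h₁', h₁.2⟩, by simpa using ⟨h₂', h₂.2⟩⟩
  · exact ⟨-1, by simpa using ⟨h₁.1.le, h₁'⟩, by simpa using ⟨h₂.1.le, h₂'⟩⟩

theorem eq_zero_or_eq_pi_of_sin_eq_zero {τ : ℝ} (hτ : τ ∈ Set.Ioc (-Real.pi) Real.pi)
    (h : Real.sin τ = 0) : τ = 0 ∨ τ = Real.pi := by
  rcases hτ.2.eq_or_lt with hπ | hπ
  · exact .inr hπ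
  · exact .inl ((Real.sin_eq_zero_iff_of_lt_of_lt hτ.1 hπ).1 h)

theorem eq_of_cos_eq_cos_of_sin_eq_zero {τ t : ℝ} (hτ : τ ∈ Set.Ioc (-Real.pi) Real.pi)
    (ht : t ∈ Set.Ioc (-Real.pi) Real.pi) (hsin : Real.sin τ = 0)
    (hcos : Real.cos τ = Real.cos t) : τ = t := by
  obtain h | h := eq_or_eq_neg_of_cos_eq_cos (Set.Ioc_subset_Icc_self hτ)
    (Set.Ioc_subset_Icc_self ht) hcos
  · exact h
  · obtain h0 | hπ := eq_zero_or_eq_pi_of_sin_eq_zero hτ hsin <;> grind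

theorem eq_or_eq_of_cos_eq_cos_of_sin_eq_zero {τ t₁ t₂ : ℝ}
    (hτ : τ ∈ Set.Ioc (-Real.pi) Real.pi) (h₁ : t₁ ∈ Set.Ioc (-Real.pi) Real.pi)
    (h₂ : t₂ ∈ Set.Ioc (-Real.pi) Real.pi) (hsin : Real.sin τ = 0)
    (hcos : Real.cos τ = Real.cos t₁ ∨ Real.cos τ = Real.cos t₂) : τ = t₁ ∨ τ = t₂ :=
  hcos.imp (eq_of_cos_eq_cos_of_sin_eq_zero hτ h₁ hsin)
    (eq_of_cos_eq_cos_of_sin_eq_zero hτ h₂ hsin)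

end Angles

end SpectralRep

end

open SpectralRep in
theorem mainTheorem4_general {Ω : Type*} [MeasurableSpace Ω] {μ : Measure Ω} {m : ℕ}
    {y : ℤ → Ω → EuclideanSpace ℝ (Fin m)} (hy : IsStationaryGaussian μ y) :
    (∀ t₁ t₂ : ℝ, IsSpectralIncrement μ y t₁ t₂ (yhat μ y t₁ t₂)) ∧
    (∀ t₁ t₂ : ℝ, ∀ᵐ ω ∂μ, ∀ i : Fin m,
      yhat μ y (-t₂) (-t₁) ω i = starRingEnd ℂ (yhat μ y t₁ t₂ ω i)) ∧
    (∀ (k : ℤ), ∀ t₁ ∈ Set.Icc (k * Real.pi) ((k + 1) * Real.pi),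
      ∀ t₂ ∈ Set.Icc (k * Real.pi) ((k + 1) * Real.pi),
      (t₁ ≠ t₂ → ∀ τ ∈ Set.Ioc (-Real.pi) Real.pi, Real.sin τ = 0 →
        Real.cos τ = Real.cos t₁ ∨ Real.cos τ = Real.cos t₂ → NoSpectralMassAt μ y τ) →
      IsCircularlySymmetricGaussian μ (yhat μ y t₁ t₂)) ∧
    (∀ t₁ t₂ t₃ t₄ : ℝ,
      (∀ s ∈ Set.uIcc t₁ t₂, ∀ s' ∈ Set.uIcc t₃ t₄, Real.cos s ≠ Real.cos s') →
      IndepFun (yhat μ y t₁ t₂) (yhat μ y t₃ t₄) μ) := by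
  have hyhat := isSpectralIncrement_yhat hy
  refine ⟨hyhat, fun t₁ t₂ => ?_, fun k t₁ h₁ t₂ h₂ hmass => ?_, fun t₁ t₂ t₃ t₄ hcos => ?_⟩
  · filter_upwards [(hyhat (-t₂) (-t₁)).ae_eq hy.gaussian (hyhat t₁ t₂).conj] with ω hω i
    rw [hω]
    rfl
  · exact (hyhat t₁ t₂).isCircularlySymmetricGaussian hy
      (spectrallyDisjoint_neg_of_mem_Icc h₁ h₂ hmass)
  · refine (hyhat t₁ t₂).indepFun hy (hyhat t₃ t₄) (spectrallyDisjoint_of_cos_ne hcos)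
      (spectrallyDisjoint_of_cos_ne fun s hs => ?_)
    rw [← Real.cos_neg s]
    exact hcos (-s) (neg_mem_uIcc_of_mem_uIcc_neg hs)

theorem mainTheorem4 {Ω : Type*} [MeasurableSpace Ω] (μ : Measure Ω) [IsProbabilityMeasure μ]
    {m : ℕ} (y : ℤ → Ω → EuclideanSpace ℝ (Fin m))
    (hy : SpectralRep.IsStationaryGaussian μ y) :
    -- the series defining the increments converges in mean square
    (∀ t₁ ∈ Set.Icc (-Real.pi) Real.pi, ∀ t₂ ∈ Set.Icc (-Real.pi) Real.pi,
      SpectralRep.IsSpectralIncrement μ y t₁ t₂ (SpectralRep.yhat μ y t₁ t₂)) ∧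
    -- Hermitian symmetry
    (∀ t₁ ∈ Set.Ioc (-Real.pi) Real.pi, ∀ t₂ ∈ Set.Ioc (-Real.pi) Real.pi,
      ∀ᵐ ω ∂μ, ∀ i : Fin m,
        SpectralRep.yhat μ y (-t₂) (-t₁) ω i = starRingEnd ℂ (SpectralRep.yhat μ y t₁ t₂ ω i)) ∧
    -- circular symmetry for angles of the same sign
    (∀ t₁ ∈ Set.Ioc (-Real.pi) Real.pi, ∀ t₂ ∈ Set.Ioc (-Real.pi) Real.pi,
      ((0 ≤ t₁ ∧ 0 ≤ t₂) ∨ (t₁ ≤ 0 ∧ t₂ ≤ 0)) →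
      (t₁ ≠ t₂ → ∀ τ : ℝ, (τ = t₁ ∨ τ = t₂) → (τ = 0 ∨ τ = Real.pi) →
        SpectralRep.NoSpectralMassAt μ y τ) →
      SpectralRep.IsCircularlySymmetricGaussian μ (SpectralRep.yhat μ y t₁ t₂)) ∧
    -- independence
    (∀ t₁ ∈ Set.Ioc (-Real.pi) Real.pi, ∀ t₂ ∈ Set.Ioc (-Real.pi) Real.pi,
      ∀ t₃ ∈ Set.Ioc (-Real.pi) Real.pi, ∀ t₄ ∈ Set.Ioc (-Real.pi) Real.pi,
      t₁ ≤ t₂ → t₃ ≤ t₄ →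
      Set.Icc t₁ t₂ ∩ Set.Icc t₃ t₄ = ∅ →
      Set.Icc t₁ t₂ ∩ Set.Icc (-t₄) (-t₃) = ∅ →
      IndepFun (SpectralRep.yhat μ y t₁ t₂) (SpectralRep.yhat μ y t₃ t₄) μ) := by
  obtain ⟨hincr, hherm, hcirc, hindep⟩ := mainTheorem4_general hy
  refine ⟨fun t₁ _ t₂ _ => hincr t₁ t₂, fun t₁ _ t₂ _ => hherm t₁ t₂,
    fun t₁ h₁ t₂ h₂ hsign hmass => ?_, fun t₁ h₁ t₂ h₂ t₃ h₃ t₄ h₄ h₁₂ h₃₄ h h' => ?_⟩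
  · obtain ⟨k, hk₁, hk₂⟩ := SpectralRep.exists_mem_Icc_int_mul_pi_of_same_sign h₁ h₂ hsign
    exact hcirc k t₁ hk₁ t₂ hk₂ fun hne τ hτ hsin hcos => hmass hne τ
      (SpectralRep.eq_or_eq_of_cos_eq_cos_of_sin_eq_zero hτ h₁ h₂ hsin hcos)
      (SpectralRep.eq_zero_or_eq_pi_of_sin_eq_zero hτ hsin)
  · exact hindep t₁ t₂ t₃ t₄ (SpectralRep.cos_ne_cos_of_Icc_inter_eq_empty h₁₂ h₃₄ h₁.1.le h₂.2
      h₃.1.le h₄.2 h h')
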